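/- Let $X,Y$ be Polish spaces, equipped with their Borel $\sigma$-fields and with metrics inducing their topologies. Let $d\ge 1$, and let $\boldsymbol\mu=(\mu_1,\dots,\mu_d)$ and $\boldsymbol\nu=(\nu_1,\dots,\nu_d)$ be tuples of finite non-zero Borel measures on $X$ and on $Y$ respectively. Define the probability measures $$\bar\mu=\frac{\sum_{j}\mu_j}{\sum_{j}\mu_j(X)},\qquad \bar\nu=\frac{\sum_{j}\nu_j}{\sum_{j}\nu_j(Y)},$$ and the $\mathbb R_+^d$-valued Radon–Nikodym derivatives $\boldsymbol\mu'=\mathrm d\boldsymbol\mu/\mathrm d\bar\mu$ and $\boldsymbol\nu'=\mathrm d\boldsymbol\nu/\mathrm d\bar\nu$. Let $$\Pi(\boldsymbol\mu,\boldsymbol\nu)=\Big\{\bar\mu\otimes\kappa \;:\; \kappa \text{ a stochastic kernel from } X \text{ to } Y \text{ with } \int_X\kappa(x;B)\,\mu_j(\mathrm dx)\ge \nu_j(B)\text{ for all } j \text{ and all Borel } B\subseteq Y\Big\},$$ where $(\bar\mu\otimes\kappa)(\mathrm dx,\mathrm dy)=\bar\mu(\mathrm dx)\,\kappa(x;\mathrm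 dy)$, and define $\Pi(\boldsymbol\nu,\boldsymbol\mu)$ in the same way with the roles of $(X,\boldsymbol\mu)$ and $(Y,\boldsymbol\nu)$ exchanged. Suppose that both $\Pi(\boldsymbol\mu,\boldsymbol\nu)$ and $\Pi(\boldsymbol\nu,\boldsymbol\mu)$ are non-empty (so that in particular $\mu_j(X)=\nu_j(Y)$ for all $j$), and that $c:X\times Y\to[0,\infty)$ is bounded and uniformly continuous. Then $$\inf_{\pi\in\Pi(\boldsymbol\mu,\boldsymbol\nu)}\int_{X\times Y}c\,\mathrm d\pi=\sup_{(\phi,\psi)\in\widetilde\Phi_c}\left(\int_X\phi\,\mathrm d\bar\mu+\int_Y\psi\,\mathrm d\bar\nu\right),$$ where $\widetilde\Phi_c$ is the set of pairs of real-valued functions $\phi\in L^1(\bar\mu)$, $\psi\in L^1(\bar\nu)$ such that $\phi(x)+\psi(y)\le c(x,y)$ for all $x\in X$, $y\in Y$ with $\boldsymbol\mu'(x)=\boldsymbol\nu'(y)$. Moreover, both the infimum and the supremum are attained. -/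

import Mathlib

open MeasureTheory ProbabilityTheory

noncomputable section

namespace SOT

variable {X Y : Type*} [MeasurableSpace X] [MeasurableSpace Y] {d : ℕ}

/-- The normalized average `(∑ j, μ j) / (∑ j, μ j (X))` of a tuple of measures. -/
def avg (μ : Fin d → Measure X) : Measure X :=
  (∑ j, μ j Set.univ)⁻¹ • ∑ j, μ j

/-- The vector-valued Radon-Nikodym derivative of the tuple with respect to its average. -/
def density (μ : Fin d → Measure X) (x : X) : Fin d → ℝ :=
  fun j => ((μ j).rnDeriv (avg μ) x).toReal

/-- The set of simultaneous transport kernels: stochastic kernels `κ` such that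
`∫ κ(x; B) μ j (dx) ≥ ν j (B)` for all `j` and all measurable `B`. -/
def transportKernels (μ : Fin d → Measure X) (ν : Fin d → Measure Y) : Set (Kernel X Y) :=
  {κ | IsMarkovKernel κ ∧ ∀ j, ν j ≤ (μ j).bind κ}

/-- The set of simultaneous transport plans: the joint measures `avg μ (dx) κ(x; dy)` obtained
from simultaneous transport kernels `κ`. -/
def transportPlans (μ : Fin d → Measure X) (ν : Fin d → Measure Y) : Set (Measure (X × Y)) :=
  {π | ∃ κ ∈ transportKernels μ ν, π = (avg μ).compProd κ}

/-- The dual feasible pairs: integrable `φ`, `ψ` with `φ x + ψ y ≤ c (x, y)` whenever the densities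
of the two tuples agree at `x` and `y`. -/
def dualPairs (μ : Fin d → Measure X) (ν : Fin d → Measure Y) (c : X × Y → ℝ) :
    Set ((X → ℝ) × (Y → ℝ)) :=
  {p | Integrable p.1 (avg μ) ∧ Integrable p.2 (avg ν) ∧
    ∀ x y, density μ x = density ν y → p.1 x + p.2 y ≤ c (x, y)}

end SOT

end

noncomputable section

namespace SOT

/-! Because transport is possible in both directions, total masses agree and every transport kernel
pushes `μ j` exactly to `ν j`. Under such a plan the density of `ν` is the conditional expectation
of the density of `μ` given `y`, so the mean square difference of the two densities is the drop in
their second moments. A plan in the other direction gives the opposite drop, so both vanish. Hence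
plans are precisely the couplings of the averages that live on the set where the densities agree
(`transportPlans_subset`, `mem_transportPlans`), and the problem becomes ordinary optimal transport
with that constraint.

For the constrained problem, Hahn-Banach gives a linear functional below the superhedging price and
equal to it at `-c` (`exists_linear_dual`). It is monotone with the right marginals, and
Riesz-Markov on the unit square turns it into a coupling on products
(`IsPreCoupling.exists_coupling`). Uniform continuity of `c` extends the identity to `c`
(`IsPreCoupling.map_eq_integral`). Rectangles missing the constraint set are null, so this coupling
is an optimal plan.

For dual attainment, fibrewise shifts and truncation confine near-optimal pairs to `[-C, C]`
(`exists_dual_abs_le`). The near-optimal pairs form decreasing convex sets, and almost minimal `L²`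
norm elements of these converge (`exists_dual_ge`). -/

/-- Bounded measurable real functions. -/
def BddMeas {X : Type*} [MeasurableSpace X] (φ : X → ℝ) : Prop :=
  Measurable φ ∧ ∃ C, ∀ x, |φ x| ≤ C

namespace BddMeas

variable {X : Type*} [MeasurableSpace X] {φ ψ : X → ℝ}

theorem integrable (h : BddMeas φ) (μ : Measure X) [IsFiniteMeasure μ] : Integrable φ μ := by
  obtain ⟨hm, C, hC⟩ := h
  exact Integrable.of_bound hm.aestronglyMeasurable C (ae_of_all _ hC)

theorem add (h : BddMeas φ) (h' : BddMeas ψ) : BddMeas (φ + ψ) := by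
  obtain ⟨hm, C, hC⟩ := h
  obtain ⟨hm', C', hC'⟩ := h'
  exact ⟨hm.add hm', C + C', fun x => (abs_add_le _ _).trans (add_le_add (hC x) (hC' x))⟩

theorem smul (h : BddMeas φ) (t : ℝ) : BddMeas (t • φ) := by
  obtain ⟨hm, C, hC⟩ := h
  refine ⟨hm.const_smul t, |t| * C, fun x => ?_⟩
  simp only [Pi.smul_apply, smul_eq_mul, abs_mul]
  exact mul_le_mul_of_nonneg_left (hC x) (abs_nonneg t)

theorem neg (h : BddMeas φ) : BddMeas (-φ) := by
  simpa using h.smul (-1)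

theorem sub (h : BddMeas φ) (h' : BddMeas ψ) : BddMeas (φ - ψ) := by
  simpa [sub_eq_add_neg] using h.add h'.neg

theorem mul (h : BddMeas φ) (h' : BddMeas ψ) : BddMeas (φ * ψ) := by
  obtain ⟨hm, C, hC⟩ := h
  obtain ⟨hm', C', hC'⟩ := h'
  refine ⟨hm.mul hm', C * C', fun x => ?_⟩
  simp only [Pi.mul_apply, abs_mul]
  exact mul_le_mul (hC x) (hC' x) (abs_nonneg _) ((abs_nonneg _).trans (hC x))

theorem const (t : ℝ) : BddMeas (fun _ : X => t) :=
  ⟨measurable_const, |t|, fun _ => le_rfl⟩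

theorem zero : BddMeas (0 : X → ℝ) := const 0

theorem abs (h : BddMeas φ) : BddMeas (fun x => |φ x|) := by
  obtain ⟨hm, C, hC⟩ := h
  exact ⟨hm.abs, C, fun x => by simpa using hC x⟩

theorem comp {Z : Type*} [MeasurableSpace Z] (h : BddMeas φ) {e : Z → X} (he : Measurable e) :
    BddMeas (φ ∘ e) := by
  obtain ⟨hm, C, hC⟩ := h
  exact ⟨hm.comp he, C, fun x => hC _⟩

theorem indicator (h : BddMeas φ) {A : Set X} (hA : MeasurableSet A) : BddMeas (A.indicator φ) := by
  obtain ⟨hm, C, hC⟩ := h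
  refine ⟨hm.indicator hA, C, fun x => ?_⟩
  by_cases hx : x ∈ A
  · simpa [hx] using hC x
  · simpa [hx] using (abs_nonneg _).trans (hC x)

end BddMeas

/-! ### The superhedging price and a Hahn-Banach functional -/

section HahnBanach

variable {X Y : Type*} [MeasurableSpace X] [MeasurableSpace Y]

/-- Pairs of bounded measurable functions whose direct sum dominates `h` along `R`. -/
def superPairs (R : X → Y → Prop) (h : X × Y → ℝ) : Set ((X → ℝ) × (Y → ℝ)) :=
  {p | BddMeas p.1 ∧ BddMeas p.2 ∧ ∀ x y, R x y → h (x, y) ≤ p.1 x + p.2 y}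

/-- The superhedging price of `h` along `R`. -/
def upperCost (μ : Measure X) (ν : Measure Y) (R : X → Y → Prop) (h : X × Y → ℝ) : ℝ :=
  sInf ((fun p : (X → ℝ) × (Y → ℝ) => (∫ x, p.1 x ∂μ) + ∫ y, p.2 y ∂ν) '' superPairs R h)

/-- The submodule of bounded functions. -/
def boundedFunctions (α : Type*) : Submodule ℝ (α → ℝ) where
  carrier := {h | ∃ C, ∀ a, |h a| ≤ C}
  zero_mem' := ⟨0, by simp⟩
  add_mem' := by
    rintro a b ⟨C, hC⟩ ⟨C', hC'⟩
    exact ⟨C + C', fun x => (abs_add_le _ _).trans (add_le_add (hC x) (hC' x))⟩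
  smul_mem' := by
    rintro t a ⟨C, hC⟩
    refine ⟨|t| * C, fun x => ?_⟩
    simp only [Pi.smul_apply, smul_eq_mul, abs_mul]
    exact mul_le_mul_of_nonneg_left (hC x) (abs_nonneg t)

theorem integral_add_integral_of_coupling {μ : Measure X} {ν : Measure Y}
    {γ : Measure (X × Y)} (h1 : γ.fst = μ) (h2 : γ.snd = ν) {φ : X → ℝ} {ψ : Y → ℝ}
    (hφ : Integrable φ μ) (hψ : Integrable ψ ν) :
    Integrable (fun z : X × Y => φ z.1 + ψ z.2) γ ∧
      ∫ z, (φ z.1 + ψ z.2) ∂γ = (∫ x, φ x ∂μ) + ∫ y, ψ y ∂ν := by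
  subst h1 h2
  have i1 : Integrable (fun z : X × Y => φ z.1) γ :=
    (integrable_map_measure hφ.1 measurable_fst.aemeasurable).1 hφ
  have i2 : Integrable (fun z : X × Y => ψ z.2) γ :=
    (integrable_map_measure hψ.1 measurable_snd.aemeasurable).1 hψ
  refine ⟨i1.add i2, ?_⟩
  rw [integral_add i1 i2]
  congr 1
  · exact (integral_map measurable_fst.aemeasurable hφ.1).symm
  · exact (integral_map measurable_snd.aemeasurable hψ.1).symm

variable {μ : Measure X} {ν : Measure Y} [IsProbabilityMeasure μ] [IsProbabilityMeasure ν]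
  {R : X → Y → Prop} {γ : Measure (X × Y)}

theorem superPairs_nonempty {h : X × Y → ℝ} (hh : h ∈ boundedFunctions (X × Y)) :
    (superPairs R h).Nonempty := by
  obtain ⟨C, hC⟩ := hh
  exact ⟨(fun _ => C, fun _ => 0), BddMeas.const C, BddMeas.const 0,
    fun x y _ => by simpa using (le_abs_self _).trans (hC (x, y))⟩

/-- Integrating against one feasible coupling `γ` bounds all prices from below. Without such a `γ`
the set of prices could be unbounded below and its `sInf` meaningless. -/
theorem neg_le_of_mem_superPairs (h1 : γ.fst = μ) (h2 : γ.snd = ν) (hR : ∀ᵐ z ∂γ, R z.1 z.2)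
    {h : X × Y → ℝ} {C : ℝ} (hC : ∀ z, |h z| ≤ C) {p : (X → ℝ) × (Y → ℝ)}
    (hp : p ∈ superPairs R h) : -C ≤ (∫ x, p.1 x ∂μ) + ∫ y, p.2 y ∂ν := by
  obtain ⟨hi, he⟩ := integral_add_integral_of_coupling h1 h2 (hp.1.integrable μ)
    (hp.2.1.integrable ν)
  have : IsProbabilityMeasure γ := ⟨by rw [← Measure.fst_univ, h1]; simp⟩
  rw [← he]
  calc -C = ∫ _, -C ∂γ := by simp
    _ ≤ _ := integral_mono_ae (integrable_const _) hi <| by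
      filter_upwards [hR] with z hz
      exact (abs_le.1 (hC z)).1.trans (hp.2.2 _ _ hz)

theorem upperCost_le (h1 : γ.fst = μ) (h2 : γ.snd = ν) (hR : ∀ᵐ z ∂γ, R z.1 z.2)
    {h : X × Y → ℝ} (hh : h ∈ boundedFunctions (X × Y)) {p : (X → ℝ) × (Y → ℝ)}
    (hp : p ∈ superPairs R h) : upperCost μ ν R h ≤ (∫ x, p.1 x ∂μ) + ∫ y, p.2 y ∂ν := by
  obtain ⟨C, hC⟩ := hh
  refine csInf_le ⟨-C, ?_⟩ (Set.mem_image_of_mem _ hp)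
  rintro _ ⟨q, hq, rfl⟩
  exact neg_le_of_mem_superPairs h1 h2 hR hC hq

omit [IsProbabilityMeasure μ] [IsProbabilityMeasure ν] in
theorem exists_lt_upperCost_add {h : X × Y → ℝ} (hh : h ∈ boundedFunctions (X × Y)) {ε : ℝ}
    (hε : 0 < ε) : ∃ p ∈ superPairs R h,
      (∫ x, p.1 x ∂μ) + ∫ y, p.2 y ∂ν < upperCost μ ν R h + ε := by
  obtain ⟨_, ⟨p, hp, rfl⟩, h⟩ := exists_lt_of_csInf_lt
    ((superPairs_nonempty (R := R) hh).image fun p => (∫ x, p.1 x ∂μ) + ∫ y, p.2 y ∂ν)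
    (lt_add_of_pos_right _ hε)
  exact ⟨p, hp, h⟩

theorem upperCost_add_le (h1 : γ.fst = μ) (h2 : γ.snd = ν) (hR : ∀ᵐ z ∂γ, R z.1 z.2)
    {h k : X × Y → ℝ} (hh : h ∈ boundedFunctions (X × Y)) (hk : k ∈ boundedFunctions (X × Y)) :
    upperCost μ ν R (h + k) ≤ upperCost μ ν R h + upperCost μ ν R k := by
  refine le_of_forall_pos_le_add fun ε hε => ?_
  obtain ⟨p, hp, hp'⟩ := exists_lt_upperCost_add (μ := μ) (ν := ν) (R := R) hh (half_pos hε)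
  obtain ⟨q, hq, hq'⟩ := exists_lt_upperCost_add (μ := μ) (ν := ν) (R := R) hk (half_pos hε)
  have := upperCost_le h1 h2 hR (add_mem hh hk) (p := p + q)
    ⟨hp.1.add hq.1, hp.2.1.add hq.2.1, fun x y hxy => by
      have a := hp.2.2 x y hxy
      have b := hq.2.2 x y hxy
      simp only [Pi.add_apply, Prod.fst_add, Prod.snd_add]
      linarith⟩
  simp only [Prod.fst_add, Prod.snd_add, Pi.add_apply] at this
  rw [integral_add (hp.1.integrable μ) (hq.1.integrable μ),
    integral_add (hp.2.1.integrable ν) (hq.2.1.integrable ν)] at this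
  linarith

theorem upperCost_smul_le (h1 : γ.fst = μ) (h2 : γ.snd = ν) (hR : ∀ᵐ z ∂γ, R z.1 z.2)
    {h : X × Y → ℝ} (hh : h ∈ boundedFunctions (X × Y)) {t : ℝ} (ht : 0 < t) :
    upperCost μ ν R (t • h) ≤ t * upperCost μ ν R h := by
  refine le_of_forall_pos_le_add fun ε hε => ?_
  obtain ⟨p, hp, hp'⟩ := exists_lt_upperCost_add (μ := μ) (ν := ν) (R := R) hh (div_pos hε ht)
  have := upperCost_le h1 h2 hR (Submodule.smul_mem _ t hh) (p := t • p)
    ⟨hp.1.smul t, hp.2.1.smul t, fun x y hxy => by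
      have a := mul_le_mul_of_nonneg_left (hp.2.2 x y hxy) ht.le
      simp only [Pi.smul_apply, Prod.smul_fst, Prod.smul_snd, smul_eq_mul]
      linarith⟩
  simp only [Prod.smul_fst, Prod.smul_snd, Pi.smul_apply, smul_eq_mul, integral_const_mul] at this
  have h3 := mul_lt_mul_of_pos_left hp' ht
  rw [mul_add, mul_add, mul_div_cancel₀ _ ht.ne'] at h3
  linarith

theorem upperCost_smul (h1 : γ.fst = μ) (h2 : γ.snd = ν) (hR : ∀ᵐ z ∂γ, R z.1 z.2)
    {h : X × Y → ℝ} (hh : h ∈ boundedFunctions (X × Y)) {t : ℝ} (ht : 0 < t) :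
    upperCost μ ν R (t • h) = t * upperCost μ ν R h := by
  refine le_antisymm (upperCost_smul_le h1 h2 hR hh ht) ?_
  have := upperCost_smul_le h1 h2 hR (Submodule.smul_mem _ t hh) (inv_pos.2 ht)
  rw [smul_smul, inv_mul_cancel₀ ht.ne', one_smul] at this
  calc t * upperCost μ ν R h ≤ t * (t⁻¹ * upperCost μ ν R (t • h)) :=
        mul_le_mul_of_nonneg_left this ht.le
    _ = _ := by rw [← mul_assoc, mul_inv_cancel₀ ht.ne', one_mul]

/-- A linear functional dominated by the superhedging price and touching it at `-c`. -/
theorem exists_linear_dual (h1 : γ.fst = μ) (h2 : γ.snd = ν) (hR : ∀ᵐ z ∂γ, R z.1 z.2)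
    {c : X × Y → ℝ} (hc : c ∈ boundedFunctions (X × Y)) :
    ∃ Λ : (X × Y → ℝ) →ₗ[ℝ] ℝ,
      (∀ h ∈ boundedFunctions (X × Y), ∀ p ∈ superPairs R h,
        Λ h ≤ (∫ x, p.1 x ∂μ) + ∫ y, p.2 y ∂ν) ∧
      ∀ ε > 0, ∃ p ∈ superPairs R (-c), (∫ x, p.1 x ∂μ) + ∫ y, p.2 y ∂ν < Λ (-c) + ε := by
  let E := boundedFunctions (X × Y)
  let N : E → ℝ := fun h => upperCost μ ν R h
  have N_hom : ∀ t : ℝ, 0 < t → ∀ h, N (t • h) = t * N h := fun t ht h =>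
    upperCost_smul h1 h2 hR h.2 ht
  have N_add : ∀ h k, N (h + k) ≤ N h + N k := fun h k => upperCost_add_le h1 h2 hR h.2 k.2
  let e : E := -⟨c, hc⟩
  have N_0 : N 0 = 0 := by
    have := N_hom 2 (by norm_num) 0
    rw [smul_zero] at this
    linarith
  have key : ∃ G : E →ₗ[ℝ] ℝ, G e = N e ∧ ∀ h, G h ≤ N h := by
    -- A functional on the span of `e` can be prescribed only for nonzero `e`; for `e = 0` contact
    -- is automatic because `N 0 = 0`.
    by_cases he : e = 0
    · obtain ⟨G, -, hG⟩ := exists_extension_of_le_sublinear (⊥ : E →ₗ.[ℝ] ℝ) N N_hom N_add (by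
        rintro ⟨x, hx⟩
        have hx' : x = 0 := (Submodule.mem_bot ℝ).1 hx
        subst hx'
        simp only [N_0]
        exact (LinearPMap.map_zero _).le)
      exact ⟨G, by rw [he, map_zero, N_0], hG⟩
    · obtain ⟨G, hG1, hG⟩ := exists_extension_of_le_sublinear
        (LinearPMap.mkSpanSingleton (σ := RingHom.id ℝ) e (N e) he) N N_hom N_add (by
        rintro ⟨x, hx⟩
        obtain ⟨t, rfl⟩ := Submodule.mem_span_singleton.1 hx
        have h3 : LinearPMap.mkSpanSingleton (σ := RingHom.id ℝ) e (N e) he ⟨t • e, hx⟩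
            = t • N e := LinearPMap.mkSpanSingleton'_apply e (N e) _ t hx
        change LinearPMap.mkSpanSingleton (σ := RingHom.id ℝ) e (N e) he ⟨t • e, hx⟩ ≤ N (t • e)
        rw [h3, smul_eq_mul]
        rcases lt_trichotomy t 0 with ht | rfl | ht
        -- For negative `t`, subadditivity on `t • e` and its opposite gives `0 ≤ N (t • e) - t * N
        -- e`.
        · have a := N_add (t • e) ((-t) • e)
          rw [← add_smul, add_neg_cancel, zero_smul, N_0, N_hom (-t) (by linarith)] at a
          linarith
        · simp [N_0]
        · rw [N_hom t ht])
      refine ⟨G, ?_, hG⟩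
      have := hG1 ⟨e, Submodule.mem_span_singleton_self e⟩
      rw [this]
      exact LinearPMap.mkSpanSingleton_apply ℝ ℝ he (N e)
  obtain ⟨G, hGe, hG⟩ := key
  -- An arbitrary linear extension to all functions; only its values on bounded functions are
  -- controlled.
  obtain ⟨Λ, hΛ⟩ := G.exists_extend
  have hΛ' : ∀ h (hh : h ∈ E), Λ h = G ⟨h, hh⟩ := fun h hh => by
    rw [← hΛ]; rfl
  refine ⟨Λ, fun h hh p hp => ?_, fun ε hε => ?_⟩
  · rw [hΛ' h hh]
    exact (hG _).trans (upperCost_le h1 h2 hR hh hp)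
  · have : Λ (-c) = upperCost μ ν R (-c) := by
      rw [hΛ' (-c) (neg_mem hc)]
      exact hGe
    rw [this]
    exact exists_lt_upperCost_add (neg_mem hc) hε

end HahnBanach

/-! ### From a monotone functional to a coupling -/

section Representation

variable {X Y : Type*} [MeasurableSpace X] [MeasurableSpace Y]

/-- A functional on functions on `X × Y` that is monotone on bounded functions and has marginals
`μ` and `ν`. -/
structure IsPreCoupling (Λ : (X × Y → ℝ) →ₗ[ℝ] ℝ) (μ : Measure X) (ν : Measure Y) : Prop where
  mono : ∀ h ∈ boundedFunctions (X × Y), ∀ k ∈ boundedFunctions (X × Y), h ≤ k → Λ h ≤ Λ k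
  fst : ∀ φ : X → ℝ, BddMeas φ → Λ (fun z => φ z.1) = ∫ x, φ x ∂μ
  snd : ∀ ψ : Y → ℝ, BddMeas ψ → Λ (fun z => ψ z.2) = ∫ y, ψ y ∂ν

theorem BddMeas.prod_mul {φ : X → ℝ} {ψ : Y → ℝ} (hφ : BddMeas φ) (hψ : BddMeas ψ) :
    BddMeas (fun z : X × Y => φ z.1 * ψ z.2) :=
  (hφ.comp measurable_fst).mul (hψ.comp measurable_snd)

variable {Λ : (X × Y → ℝ) →ₗ[ℝ] ℝ} {μ : Measure X} {ν : Measure Y}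

namespace IsPreCoupling

theorem abs_le (h : IsPreCoupling Λ μ ν) {u b : X × Y → ℝ} (hu : u ∈ boundedFunctions (X × Y))
    (hb : b ∈ boundedFunctions (X × Y)) (hub : ∀ z, |u z| ≤ b z) : |Λ u| ≤ Λ b := by
  rw [_root_.abs_le]
  constructor
  · rw [← map_neg]
    exact h.mono _ (neg_mem hb) _ hu fun z => (_root_.abs_le.1 (hub z)).1
  · exact h.mono _ hu _ hb fun z => (_root_.abs_le.1 (hub z)).2

theorem abs_prod_le_left (h : IsPreCoupling Λ μ ν) {φ : X → ℝ} {ψ : Y → ℝ} (hφ : BddMeas φ)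
    (hψ : BddMeas ψ) {C : ℝ} (hC : ∀ y, |ψ y| ≤ C) :
    |Λ fun z => φ z.1 * ψ z.2| ≤ C * ∫ x, |φ x| ∂μ := by
  have hb : BddMeas (fun x => C * |φ x|) := (BddMeas.const C).mul hφ.abs
  refine (h.abs_le (hφ.prod_mul hψ).2 (hb.comp measurable_fst).2 fun z => ?_).trans_eq ?_
  · simp only [Function.comp, abs_mul]
    rw [mul_comm]
    exact mul_le_mul_of_nonneg_right (hC _) (abs_nonneg _)
  · rw [← integral_const_mul]
    exact h.fst _ hb

theorem abs_prod_le_right (h : IsPreCoupling Λ μ ν) {φ : X → ℝ} {ψ : Y → ℝ} (hφ : BddMeas φ)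
    (hψ : BddMeas ψ) {C : ℝ} (hC : ∀ x, |φ x| ≤ C) :
    |Λ fun z => φ z.1 * ψ z.2| ≤ C * ∫ y, |ψ y| ∂ν := by
  have hb : BddMeas (fun y => C * |ψ y|) := (BddMeas.const C).mul hψ.abs
  refine (h.abs_le (hφ.prod_mul hψ).2 (hb.comp measurable_snd).2 fun z => ?_).trans_eq ?_
  · simp only [Function.comp, abs_mul]
    exact mul_le_mul_of_nonneg_right (hC _) (abs_nonneg _)
  · rw [← integral_const_mul]
    exact h.snd _ hb

end IsPreCoupling

theorem abs_integral_prod_le_left {π : Measure (X × Y)} [IsFiniteMeasure π] (h1 : π.fst = μ)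
    {φ : X → ℝ} {ψ : Y → ℝ} (hφ : BddMeas φ) (hψ : BddMeas ψ) {C : ℝ} (hC : ∀ y, |ψ y| ≤ C) :
    |∫ z, φ z.1 * ψ z.2 ∂π| ≤ C * ∫ x, |φ x| ∂μ := by
  have hb : BddMeas (fun x => C * |φ x|) := (BddMeas.const C).mul hφ.abs
  refine (abs_integral_le_integral_abs).trans ?_
  rw [← integral_const_mul, ← h1, Measure.fst, integral_map measurable_fst.aemeasurable
    hb.1.aestronglyMeasurable]
  refine integral_mono ((hφ.prod_mul hψ).abs.integrable π)
    ((hb.comp measurable_fst).integrable π) fun z => ?_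
  simp only [abs_mul]
  rw [mul_comm]
  exact mul_le_mul_of_nonneg_right (hC _) (abs_nonneg _)

theorem abs_integral_prod_le_right {π : Measure (X × Y)} [IsFiniteMeasure π] (h2 : π.snd = ν)
    {φ : X → ℝ} {ψ : Y → ℝ} (hφ : BddMeas φ) (hψ : BddMeas ψ) {C : ℝ} (hC : ∀ x, |φ x| ≤ C) :
    |∫ z, φ z.1 * ψ z.2 ∂π| ≤ C * ∫ y, |ψ y| ∂ν := by
  have hb : BddMeas (fun y => C * |ψ y|) := (BddMeas.const C).mul hψ.abs
  refine (abs_integral_le_integral_abs).trans ?_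
  rw [← integral_const_mul, ← h2, Measure.snd, integral_map measurable_snd.aemeasurable
    hb.1.aestronglyMeasurable]
  refine integral_mono ((hφ.prod_mul hψ).abs.integrable π)
    ((hb.comp measurable_snd).integrable π) fun z => ?_
  simp only [abs_mul]
  exact mul_le_mul_of_nonneg_right (hC _) (abs_nonneg _)

-- Any `φ` factors through the embedding `e`, and continuous functions are dense in `L¹` of the
-- image measure on the interval.
open unitInterval in
theorem exists_continuous_integral_abs_sub_le [IsFiniteMeasure μ] {e : X → I}
    (he : MeasurableEmbedding e) {φ : X → ℝ} (hφ : BddMeas φ) {ε : ℝ} (hε : 0 < ε) :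
    ∃ u : C(I, ℝ), ∫ x, |φ x - u (e x)| ∂μ ≤ ε := by
  obtain ⟨φ', hm, rfl⟩ := he.exists_measurable_extend hφ.1 fun _ => inferInstance
  have hi : Integrable φ' (μ.map e) := he.integrable_map_iff.2 (hφ.integrable μ)
  obtain ⟨u, hu, -⟩ := hi.exists_boundedContinuous_integral_sub_le hε
  refine ⟨u.toContinuousMap, ?_⟩
  rw [he.integral_map] at hu
  exact hu

open unitInterval in
theorem BddMeas.of_continuousMap {e : X → I} (he : Measurable e) (u : C(I, ℝ)) :
    BddMeas (fun x => u (e x)) :=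
  ⟨u.continuous.measurable.comp he, ‖u‖, fun x => u.norm_coe_le_norm (e x)⟩

open unitInterval CompactlySupported in
/-- The positive functional on continuous functions of the unit square induced by a
pre-coupling. -/
def IsPreCoupling.toPositiveLinearMap (h : IsPreCoupling Λ μ ν) (ρ : X × Y → I × I) :
    C_c(I × I, ℝ) →ₚ[ℝ] ℝ where
  toFun g := Λ (g ∘ ρ)
  map_add' g g' := by
    rw [← map_add]; rfl
  map_smul' t g := by
    rw [RingHom.id_apply, ← map_smul]; rfl
  monotone' g g' hg := h.mono _
    ⟨‖g.toBoundedContinuousFunction‖, fun z =>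
      g.toBoundedContinuousFunction.norm_coe_le_norm (ρ z)⟩ _
    ⟨‖g'.toBoundedContinuousFunction‖, fun z =>
      g'.toBoundedContinuousFunction.norm_coe_le_norm (ρ z)⟩ fun z => hg (ρ z)

-- Riesz-Markov applies because the square is compact; `Λ` itself need not be countably additive.
open unitInterval in
theorem IsPreCoupling.exists_square_measure (h : IsPreCoupling Λ μ ν) (ρ : X × Y → I × I) :
    ∃ P : Measure (I × I), IsFiniteMeasure P ∧
      ∀ u : C(I × I, ℝ), ∫ z, u z ∂P = Λ (fun z => u (ρ z)) := by
  refine ⟨RealRMK.rieszMeasure (h.toPositiveLinearMap ρ), ⟨isCompact_univ.measure_lt_top⟩,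
    fun u => ?_⟩
  exact RealRMK.integral_rieszMeasure (h.toPositiveLinearMap ρ)
    ⟨u, HasCompactSupport.of_compactSpace u⟩

variable [StandardBorelSpace X] [StandardBorelSpace Y] [IsProbabilityMeasure μ]
  [IsProbabilityMeasure ν]

open unitInterval in
/-- A pre-coupling on standard Borel spaces agrees with a coupling on products. -/
theorem IsPreCoupling.exists_coupling (h : IsPreCoupling Λ μ ν) :
    ∃ π : Measure (X × Y), π.fst = μ ∧ π.snd = ν ∧ ∀ φ ψ, BddMeas φ → BddMeas ψ →
      Λ (fun z => φ z.1 * ψ z.2) = ∫ z, φ z.1 * ψ z.2 ∂π := by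
  obtain ⟨e₁, he₁⟩ : ∃ e : X → I, MeasurableEmbedding e :=
    ⟨_, measurableEmbedding_sigmoid_comp_embeddingReal X⟩
  obtain ⟨e₂, he₂⟩ : ∃ e : Y → I, MeasurableEmbedding e :=
    ⟨_, measurableEmbedding_sigmoid_comp_embeddingReal Y⟩
  have hρ : MeasurableEmbedding (Prod.map e₁ e₂) := he₁.prodMap he₂
  obtain ⟨P, hPf, hP⟩ := h.exists_square_measure (Prod.map e₁ e₂)
  have hP1 : P.fst = μ.map e₁ := by
    refine ext_of_forall_integral_eq_of_IsFiniteMeasure fun u => ?_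
    rw [Measure.fst, integral_map measurable_fst.aemeasurable
      u.continuous.measurable.aestronglyMeasurable, he₁.integral_map]
    exact (hP (u.toContinuousMap.comp ⟨Prod.fst, continuous_fst⟩)).trans
      (h.fst _ (BddMeas.of_continuousMap he₁.measurable u.toContinuousMap))
  have hP2 : P.snd = ν.map e₂ := by
    refine ext_of_forall_integral_eq_of_IsFiniteMeasure fun u => ?_
    rw [Measure.snd, integral_map measurable_snd.aemeasurable
      u.continuous.measurable.aestronglyMeasurable, he₂.integral_map]
    exact (hP (u.toContinuousMap.comp ⟨Prod.snd, continuous_snd⟩)).trans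
      (h.snd _ (BddMeas.of_continuousMap he₂.measurable u.toContinuousMap))
  -- The marginals of `P` are images of `μ` and `ν`, so no mass escapes the embedded copy of `X ×
  -- Y`. This replaces a tightness argument.
  have hrange : ∀ᵐ z ∂P, z ∈ Set.range (Prod.map e₁ e₂) := by
    have a1 : ∀ᵐ z ∂P, z.1 ∈ Set.range e₁ := by
      refine ae_of_ae_map (f := Prod.fst) (p := fun x => x ∈ Set.range e₁)
        measurable_fst.aemeasurable ?_
      change ∀ᵐ x ∂P.fst, _
      rw [hP1, he₁.ae_map_iff]
      exact ae_of_all _ fun x => Set.mem_range_self x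
    have a2 : ∀ᵐ z ∂P, z.2 ∈ Set.range e₂ := by
      refine ae_of_ae_map (f := Prod.snd) (p := fun x => x ∈ Set.range e₂)
        measurable_snd.aemeasurable ?_
      change ∀ᵐ x ∂P.snd, _
      rw [hP2, he₂.ae_map_iff]
      exact ae_of_all _ fun x => Set.mem_range_self x
    filter_upwards [a1, a2] with z h1 h2
    rw [Set.range_prodMap]
    exact ⟨h1, h2⟩
  set π := P.comap (Prod.map e₁ e₂) with hπ
  have hmap : π.map (Prod.map e₁ e₂) = P := by
    rw [hπ, hρ.map_comap, Measure.restrict_eq_self_of_ae_mem hrange]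
  have hπ1 : π.fst = μ := by
    have : (π.fst).map e₁ = μ.map e₁ := by
      rw [← hP1, ← hmap, Measure.fst, Measure.fst, Measure.map_map he₁.measurable measurable_fst,
        Measure.map_map measurable_fst hρ.measurable]
      rfl
    rw [← he₁.comap_map π.fst, this, he₁.comap_map]
  have hπ2 : π.snd = ν := by
    have : (π.snd).map e₂ = ν.map e₂ := by
      rw [← hP2, ← hmap, Measure.snd, Measure.snd, Measure.map_map he₂.measurable measurable_snd,
        Measure.map_map measurable_snd hρ.measurable]
      rfl
    rw [← he₂.comap_map π.snd, this, he₂.comap_map]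
  have : IsProbabilityMeasure π := ⟨by rw [← Measure.fst_univ, hπ1]; simp⟩
  have hcc : ∀ u v : C(I, ℝ), Λ (fun z => u (e₁ z.1) * v (e₂ z.2)) =
      ∫ z, u (e₁ z.1) * v (e₂ z.2) ∂π := fun u v => by
    have := hP (u.comp ⟨Prod.fst, continuous_fst⟩ * v.comp ⟨Prod.snd, continuous_snd⟩)
    rw [← hmap, hρ.integral_map] at this
    exact this.symm
  have hsplit₁ : ∀ φ u : X → ℝ, ∀ ψ : Y → ℝ, BddMeas φ → BddMeas u → BddMeas ψ →
      Λ (fun z => φ z.1 * ψ z.2) - ∫ z, φ z.1 * ψ z.2 ∂π =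
      (Λ (fun z => (φ - u) z.1 * ψ z.2) - ∫ z, (φ - u) z.1 * ψ z.2 ∂π) +
      (Λ (fun z => u z.1 * ψ z.2) - ∫ z, u z.1 * ψ z.2 ∂π) := by
    intro φ u ψ hφ hu hψ
    have e1 : (fun z : X × Y => φ z.1 * ψ z.2) =
        (fun z => (φ - u) z.1 * ψ z.2) + fun z => u z.1 * ψ z.2 := by
      ext z; simp only [Pi.sub_apply, Pi.add_apply]; ring
    rw [e1, map_add, integral_add' (((hφ.sub hu).prod_mul hψ).integrable π)
      ((hu.prod_mul hψ).integrable π)]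
    ring
  have hsplit₂ : ∀ φ : X → ℝ, ∀ ψ v : Y → ℝ, BddMeas φ → BddMeas ψ → BddMeas v →
      Λ (fun z => φ z.1 * ψ z.2) - ∫ z, φ z.1 * ψ z.2 ∂π =
      (Λ (fun z => φ z.1 * (ψ - v) z.2) - ∫ z, φ z.1 * (ψ - v) z.2 ∂π) +
      (Λ (fun z => φ z.1 * v z.2) - ∫ z, φ z.1 * v z.2 ∂π) := by
    intro φ ψ v hφ hψ hv
    have e1 : (fun z : X × Y => φ z.1 * ψ z.2) =
        (fun z => φ z.1 * (ψ - v) z.2) + fun z => φ z.1 * v z.2 := by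
      ext z; simp only [Pi.sub_apply, Pi.add_apply]; ring
    rw [e1, map_add, integral_add' ((hφ.prod_mul (hψ.sub hv)).integrable π)
      ((hφ.prod_mul hv).integrable π)]
    ring
  -- Measurability is gained one factor at a time: `φ` is approximated in `L¹(μ)` with the
  -- continuous factor held bounded, and afterwards `ψ` in `L¹(ν)` with `φ` held bounded.
  have hmc : ∀ φ : X → ℝ, BddMeas φ → ∀ v : C(I, ℝ), Λ (fun z => φ z.1 * v (e₂ z.2)) =
      ∫ z, φ z.1 * v (e₂ z.2) ∂π := fun φ hφ v => by
    have hv := BddMeas.of_continuousMap he₂.measurable v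
    obtain ⟨C, hC⟩ := hv.2
    have hC0 : 0 < |C| + 1 := by positivity
    have hC' : ∀ y, |v (e₂ y)| ≤ |C| + 1 := fun y => (hC y).trans (by linarith [le_abs_self C])
    refine sub_eq_zero.1 (abs_eq_zero.1 (le_antisymm (le_of_forall_pos_le_add fun ε hε => ?_)
      (abs_nonneg _)))
    obtain ⟨u, hu⟩ := exists_continuous_integral_abs_sub_le (μ := μ) he₁ hφ
      (show 0 < ε / 2 / (|C| + 1) by positivity)
    have hu' := BddMeas.of_continuousMap he₁.measurable u
    rw [hsplit₁ φ _ _ hφ hu' hv, hcc, sub_self, add_zero, zero_add]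
    have b1 := h.abs_prod_le_left (hφ.sub hu') hv hC'
    have b2 := abs_integral_prod_le_left hπ1 (hφ.sub hu') hv hC'
    have b3 := mul_le_mul_of_nonneg_left hu hC0.le
    rw [mul_div_cancel₀ _ hC0.ne'] at b3
    refine (abs_sub _ _).trans ?_
    simp only [Pi.sub_apply] at b1 b2 ⊢
    linarith
  refine ⟨π, hπ1, hπ2, fun φ ψ hφ hψ => ?_⟩
  obtain ⟨C, hC⟩ := hφ.2
  have hC0 : 0 < |C| + 1 := by positivity
  have hC' : ∀ y, |φ y| ≤ |C| + 1 := fun y => (hC y).trans (by linarith [le_abs_self C])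
  refine sub_eq_zero.1 (abs_eq_zero.1 (le_antisymm (le_of_forall_pos_le_add fun ε hε => ?_)
    (abs_nonneg _)))
  obtain ⟨v, hv⟩ := exists_continuous_integral_abs_sub_le (μ := ν) he₂ hψ
    (show 0 < ε / 2 / (|C| + 1) by positivity)
  have hv' := BddMeas.of_continuousMap he₂.measurable v
  rw [hsplit₂ φ ψ _ hφ hψ hv', hmc φ hφ, sub_self, add_zero, zero_add]
  have b1 := h.abs_prod_le_right hφ (hψ.sub hv') hC'
  have b2 := abs_integral_prod_le_right hπ2 hφ (hψ.sub hv') hC'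
  have b3 := mul_le_mul_of_nonneg_left hv hC0.le
  rw [mul_div_cancel₀ _ hC0.ne'] at b3
  refine (abs_sub _ _).trans ?_
  simp only [Pi.sub_apply] at b1 b2 ⊢
  linarith

end Representation

/-! ### Extension of the representation to uniformly continuous costs -/

section Quantization

variable {X Y : Type*} [MetricSpace X] [SecondCountableTopology X] [MeasurableSpace X]
  [BorelSpace X] [MetricSpace Y] [SecondCountableTopology Y] [MeasurableSpace Y] [BorelSpace Y]

open Filter Topology in
/-- A finite-valued measurable map that is uniformly close to the identity off a small set. -/
theorem exists_simpleFunc_dist_lt [Nonempty X] (μ : Measure X) [IsFiniteMeasure μ] {δ ε : ℝ}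
    (hδ : 0 < δ) (hε : 0 < ε) :
    ∃ q : SimpleFunc X X, ∃ N : Set X, MeasurableSet N ∧ μ.real N ≤ ε ∧
      ∀ x ∉ N, dist (q x) x < δ := by
  have ht := tendstoInMeasure_of_tendsto_ae (μ := μ) (f := fun n x =>
      SimpleFunc.nearestPt (TopologicalSpace.denseSeq X) n x) (g := id)
    (fun n => (SimpleFunc.measurable _).aestronglyMeasurable)
    (ae_of_all _ fun x => SimpleFunc.tendsto_nearestPt
      (TopologicalSpace.denseRange_denseSeq X x)) (ENNReal.ofReal δ) (by simpa using hδ)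
  obtain ⟨n, hn⟩ := (ht.eventually (gt_mem_nhds (show 0 < ENNReal.ofReal ε by simpa using hε))).exists
  refine ⟨SimpleFunc.nearestPt (TopologicalSpace.denseSeq X) n, _,
    measurableSet_le measurable_const (Measurable.edist (SimpleFunc.measurable _) measurable_id),
    ENNReal.toReal_le_of_le_ofReal hε.le hn.le, fun x hx => ?_⟩
  simp only [Set.mem_ofPred_eq, id, not_le, edist_dist] at hx
  exact (ENNReal.ofReal_lt_ofReal_iff hδ).1 hx

variable {Λ : (X × Y → ℝ) →ₗ[ℝ] ℝ} {μ : Measure X} {ν : Measure Y}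

-- A quantized cost is a finite combination of indicators of measurable rectangles, where `Λ` and
-- `π` already agree. No regularity of `c` is needed.
omit [MetricSpace X] [SecondCountableTopology X] [BorelSpace X] [MetricSpace Y]
  [SecondCountableTopology Y] [BorelSpace Y] in
theorem map_simpleFunc_comp_eq {π : Measure (X × Y)} [IsFiniteMeasure π]
    (hπ : ∀ φ ψ, BddMeas φ → BddMeas ψ →
      Λ (fun z => φ z.1 * ψ z.2) = ∫ z, φ z.1 * ψ z.2 ∂π)
    (q : SimpleFunc X X) (r : SimpleFunc Y Y) (c : X × Y → ℝ) :
    Λ (fun z => c (q z.1, r z.2)) = ∫ z, c (q z.1, r z.2) ∂π := by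
  classical
  have hq : ∀ s, BddMeas (Set.indicator (q ⁻¹' {s}) (fun _ => (1 : ℝ))) := fun s =>
    (BddMeas.const 1).indicator (q.measurableSet_fiber s)
  have hr : ∀ t, BddMeas (Set.indicator (r ⁻¹' {t}) (fun _ => (1 : ℝ))) := fun t =>
    (BddMeas.const 1).indicator (r.measurableSet_fiber t)
  have key : (fun z : X × Y => c (q z.1, r z.2)) = ∑ s ∈ q.range, ∑ t ∈ r.range,
      c (s, t) • fun z : X × Y => Set.indicator (q ⁻¹' {s}) (fun _ => (1 : ℝ)) z.1 *
        Set.indicator (r ⁻¹' {t}) (fun _ => (1 : ℝ)) z.2 := by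
    ext z
    simp only [Finset.sum_apply, Pi.smul_apply, smul_eq_mul]
    rw [Finset.sum_eq_single (q z.1), Finset.sum_eq_single (r z.2)]
    · simp
    · intro t _ ht
      simp [Ne.symm ht]
    · simp
    · intro s _ hs
      simp [Ne.symm hs]
    · simp
  have hi : ∀ s t, Integrable (c (s, t) • fun z : X × Y =>
      Set.indicator (q ⁻¹' {s}) (fun _ => (1 : ℝ)) z.1 *
        Set.indicator (r ⁻¹' {t}) (fun _ => (1 : ℝ)) z.2) π := fun s t =>
    (((hq s).prod_mul (hr t)).integrable π).smul _
  rw [key, map_sum, Finset.sum_fn, integral_finsetSum]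
  · refine Finset.sum_congr rfl fun s _ => ?_
    rw [map_sum, Finset.sum_fn, integral_finsetSum _ fun t _ => hi s t]
    refine Finset.sum_congr rfl fun t _ => ?_
    rw [map_smul, hπ _ _ (hq s) (hr t)]
    exact (integral_const_mul _ _).symm
  · intro s _
    exact integrable_finsetSum' _ fun t _ => hi s t

variable [IsProbabilityMeasure μ] [IsProbabilityMeasure ν]

/-- Quantizing both coordinates changes `c` by little except when `x` or `y` lies in a small set.
The error is dominated by a function of `x` plus a function of `y`, which both `Λ` and `π` evaluate
through the marginals alone. -/
theorem IsPreCoupling.map_eq_integral (h : IsPreCoupling Λ μ ν) {π : Measure (X × Y)}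
    (h1 : π.fst = μ) (h2 : π.snd = ν)
    (hπ : ∀ φ ψ, BddMeas φ → BddMeas ψ →
      Λ (fun z => φ z.1 * ψ z.2) = ∫ z, φ z.1 * ψ z.2 ∂π)
    {c : X × Y → ℝ} (hc : c ∈ boundedFunctions (X × Y)) (huc : UniformContinuous c) :
    Λ c = ∫ z, c z ∂π := by
  have : IsProbabilityMeasure π := ⟨by rw [← Measure.fst_univ, h1]; simp⟩
  have : Nonempty X := nonempty_of_isProbabilityMeasure μ
  have : Nonempty Y := nonempty_of_isProbabilityMeasure ν
  obtain ⟨C, hC⟩ := id hc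
  have hC0 : 0 < |C| + 1 := by positivity
  have hC' : ∀ y, |c y| ≤ |C| + 1 := fun y => (hC y).trans (by linarith [le_abs_self C])
  refine sub_eq_zero.1 (abs_eq_zero.1 (le_antisymm (le_of_forall_pos_le_add fun ε hε => ?_)
    (abs_nonneg _)))
  set D := |C| + 1
  obtain ⟨δ, hδ, hδc⟩ := Metric.uniformContinuous_iff.1 huc (ε / 10) (by positivity)
  have hη : 0 < ε / 10 / (2 * D) := by positivity
  obtain ⟨q, N, hN, hμN, hq⟩ := exists_simpleFunc_dist_lt μ hδ hη
  obtain ⟨r, M, hM, hνM, hr⟩ := exists_simpleFunc_dist_lt ν hδ hη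
  let c' : X × Y → ℝ := fun z => c (q z.1, r z.2)
  have hc' : c' ∈ boundedFunctions (X × Y) := ⟨C, fun z => hC _⟩
  let bN : X → ℝ := N.indicator fun _ => 2 * D
  let bM : Y → ℝ := M.indicator fun _ => 2 * D
  have hbN : BddMeas bN := (BddMeas.const _).indicator hN
  have hbM : BddMeas bM := (BddMeas.const _).indicator hM
  have hbN0 : ∀ x, 0 ≤ bN x := fun x => Set.indicator_nonneg (fun _ _ => by positivity) x
  have hbM0 : ∀ x, 0 ≤ bM x := fun x => Set.indicator_nonneg (fun _ _ => by positivity) x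
  have hbNi : ∫ x, bN x ∂μ ≤ ε / 10 := by
    rw [integral_indicator hN, setIntegral_const, smul_eq_mul]
    calc _ ≤ ε / 10 / (2 * D) * (2 * D) := mul_le_mul_of_nonneg_right hμN (by positivity)
      _ = _ := div_mul_cancel₀ _ (by positivity)
  have hbMi : ∫ x, bM x ∂ν ≤ ε / 10 := by
    rw [integral_indicator hM, setIntegral_const, smul_eq_mul]
    calc _ ≤ ε / 10 / (2 * D) * (2 * D) := mul_le_mul_of_nonneg_right hνM (by positivity)
      _ = _ := div_mul_cancel₀ _ (by positivity)
  -- The uniform error `ε / 10` is charged to the first coordinate. The dominating function then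
  -- costs at most `3 * ε / 10`, once under `Λ` and once under `π`.
  let a : X → ℝ := fun x => ε / 10 + bN x
  have ha : BddMeas a := (BddMeas.const (ε / 10)).add hbN
  have hai : ∫ x, a x ∂μ ≤ ε / 5 := by
    rw [integral_add (integrable_const _) (hbN.integrable μ)]
    simp only [integral_const, probReal_univ, one_smul]
    linarith
  let b : X × Y → ℝ := (fun z => a z.1) + fun z => bM z.2
  have hbb : BddMeas b := (ha.comp measurable_fst).add (hbM.comp measurable_snd)
  have hle : ∀ z, |(c - c') z| ≤ b z := by
    rintro ⟨x, y⟩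
    have hbd : |c (x, y) - c (q x, r y)| ≤ 2 * D :=
      (abs_sub _ _).trans (by linarith [hC' (x, y), hC' (q x, r y)])
    change |c (x, y) - c (q x, r y)| ≤ (ε / 10 + bN x) + bM y
    by_cases hx : x ∈ N
    · have : bN x = 2 * D := Set.indicator_of_mem hx _
      linarith [hbM0 y]
    by_cases hy : y ∈ M
    · have : bM y = 2 * D := Set.indicator_of_mem hy _
      linarith [hbN0 x]
    have := hδc (a := (x, y)) (b := (q x, r y)) (by
      rw [Prod.dist_eq]
      exact max_lt (by rw [dist_comm]; exact hq x hx) (by rw [dist_comm]; exact hr y hy))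
    rw [Real.dist_eq] at this
    linarith [hbN0 x, hbM0 y]
  have hib := integral_add_integral_of_coupling h1 h2 (ha.integrable μ) (hbM.integrable ν)
  have hb1 : Λ b ≤ 3 * ε / 10 := by
    rw [map_add, h.fst _ ha, h.snd _ hbM]
    linarith
  have hb2 : ∫ z, b z ∂π ≤ 3 * ε / 10 := by
    refine hib.2.trans_le ?_
    linarith
  have k1 := h.abs_le (sub_mem hc hc') hbb.2 hle
  have hcm : BddMeas c := ⟨huc.continuous.measurable, C, hC⟩
  have hcm' : BddMeas c' := hcm.comp ((q.measurable.comp measurable_fst).prodMk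
    (r.measurable.comp measurable_snd))
  have k2 : |∫ z, (c - c') z ∂π| ≤ ∫ z, b z ∂π :=
    abs_integral_le_integral_abs.trans
      (integral_mono ((hcm.sub hcm').abs.integrable π) (hbb.integrable π) hle)
  have k3 : Λ c' = ∫ z, c' z ∂π := map_simpleFunc_comp_eq hπ q r c
  rw [integral_sub' (hcm.integrable π) (hcm'.integrable π)] at k2
  rw [map_sub] at k1
  have : Λ c - ∫ z, c z ∂π = (Λ c - Λ c') - (∫ z, c z ∂π - ∫ z, c' z ∂π) := by rw [k3]; ring
  rw [this]
  refine (abs_sub _ _).trans ?_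
  linarith

end Quantization

/-! ### Strong duality on the set where two maps agree -/

section StrongDuality

variable {X Y : Type*} [MetricSpace X] [PolishSpace X] [MeasurableSpace X] [BorelSpace X]
  [MetricSpace Y] [PolishSpace Y] [MeasurableSpace Y] [BorelSpace Y]
  {μ : Measure X} {ν : Measure Y} [IsProbabilityMeasure μ] [IsProbabilityMeasure ν]
  {ι : Type*} [Countable ι]

/-- Strong duality, with primal attainment, for couplings concentrated on `{f x = g y}`. -/
theorem exists_coupling_forall_exists_dual {f : X → ι → ℝ} {g : Y → ι → ℝ} (hf : Measurable f)
    (hg : Measurable g) {γ : Measure (X × Y)} (h1 : γ.fst = μ) (h2 : γ.snd = ν)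
    (hγ : ∀ᵐ z ∂γ, f z.1 = g z.2) {c : X × Y → ℝ} (hc : c ∈ boundedFunctions (X × Y))
    (huc : UniformContinuous c) :
    ∃ π : Measure (X × Y), π.fst = μ ∧ π.snd = ν ∧ (∀ᵐ z ∂π, f z.1 = g z.2) ∧
      ∀ ε > 0, ∃ φ ψ, BddMeas φ ∧ BddMeas ψ ∧ (∀ x y, f x = g y → φ x + ψ y ≤ c (x, y)) ∧
        ∫ z, c z ∂π - ε < (∫ x, φ x ∂μ) + ∫ y, ψ y ∂ν := by
  obtain ⟨Λ, hΛ, hΛc⟩ := exists_linear_dual (R := fun x y => f x = g y) h1 h2 hγ hc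
  -- The pair `(0, 0)` superhedges any function that is nonpositive on the constraint set.
  have hle : ∀ h ∈ boundedFunctions (X × Y), (∀ x y, f x = g y → h (x, y) ≤ 0) → Λ h ≤ 0 := by
    intro h hh hfg
    simpa using hΛ h hh (0, 0) ⟨BddMeas.zero, BddMeas.zero, by simpa using hfg⟩
  have hfst : ∀ φ : X → ℝ, BddMeas φ → Λ (fun z => φ z.1) ≤ ∫ x, φ x ∂μ := fun φ hφ => by
    simpa using! hΛ _ (hφ.comp measurable_fst).2 (φ, 0) ⟨hφ, BddMeas.zero, by simp⟩
  have hsnd : ∀ ψ : Y → ℝ, BddMeas ψ → Λ (fun z => ψ z.2) ≤ ∫ y, ψ y ∂ν := fun ψ hψ => by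
    simpa using! hΛ _ (hψ.comp measurable_snd).2 (0, ψ) ⟨BddMeas.zero, hψ, by simp⟩
  have hpre : IsPreCoupling Λ μ ν := by
    refine ⟨fun h hh k hk hhk => ?_, fun φ hφ => le_antisymm (hfst φ hφ) ?_,
      fun ψ hψ => le_antisymm (hsnd ψ hψ) ?_⟩
    · have := hle (h - k) (sub_mem hh hk) fun x y _ => sub_nonpos.2 (hhk (x, y))
      rw [map_sub] at this
      linarith
    · have := hfst (-φ) hφ.neg
      rw [show (fun z : X × Y => (-φ) z.1) = -fun z => φ z.1 from rfl, map_neg] at this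
      simp only [Pi.neg_apply, integral_neg] at this
      linarith
    · have := hsnd (-ψ) hψ.neg
      rw [show (fun z : X × Y => (-ψ) z.2) = -fun z => ψ z.2 from rfl, map_neg] at this
      simp only [Pi.neg_apply, integral_neg] at this
      linarith
  obtain ⟨π, hπ1, hπ2, hπ⟩ := hpre.exists_coupling
  have : IsProbabilityMeasure π := ⟨by rw [← Measure.fst_univ, hπ1]; simp⟩
  have hrect : ∀ A : Set X, ∀ B : Set Y, MeasurableSet A → MeasurableSet B →
      (∀ x ∈ A, ∀ y ∈ B, f x ≠ g y) → ∀ᵐ z ∂π, ¬ (z.1 ∈ A ∧ z.2 ∈ B) := by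
    intro A B hA hB hAB
    have hA' : BddMeas (A.indicator fun _ => (1 : ℝ)) := (BddMeas.const 1).indicator hA
    have hB' : BddMeas (B.indicator fun _ => (1 : ℝ)) := (BddMeas.const 1).indicator hB
    have e := hπ _ _ hA' hB'
    have l := hle _ (hA'.prod_mul hB').2 fun x y hxy => by
      by_cases hx : x ∈ A
      · have hy : y ∉ B := fun hy => hAB x hx y hy hxy
        simp [hy]
      · simp [hx]
    rw [e] at l
    have e2 : (fun z : X × Y => A.indicator (fun _ => (1 : ℝ)) z.1 *
        B.indicator (fun _ => (1 : ℝ)) z.2) = (A ×ˢ B).indicator 1 := by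
      ext ⟨x, y⟩
      by_cases hx : x ∈ A <;> by_cases hy : y ∈ B <;> simp [hx, hy]
    rw [e2, integral_indicator_one (hA.prod hB)] at l
    have l0 : π (A ×ˢ B) = 0 := by
      rw [← measureReal_eq_zero_iff]
      exact le_antisymm l measureReal_nonneg
    exact measure_eq_zero_iff_ae_notMem.1 l0
  refine ⟨π, hπ1, hπ2, ?_, fun ε hε => ?_⟩
  -- The set `{f ≠ g}` is a countable union of rectangles: some coordinate differs, and a rational
  -- separates the two values.
  · have k1 : ∀ᵐ z ∂π, ∀ i : ι, ∀ a : ℚ, ¬ (f z.1 i < a ∧ a < g z.2 i) := by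
      simp_rw [ae_all_iff]
      exact fun i a => hrect {x | f x i < a} {y | a < g y i}
        (measurableSet_lt ((measurable_pi_apply i).comp hf) measurable_const)
        (measurableSet_lt measurable_const ((measurable_pi_apply i).comp hg))
        fun x hx y hy hxy => lt_asymm (show f x i < a from hx)
          (by rw [hxy]; exact hy)
    have k2 : ∀ᵐ z ∂π, ∀ i : ι, ∀ a : ℚ, ¬ (a < f z.1 i ∧ g z.2 i < a) := by
      simp_rw [ae_all_iff]
      exact fun i a => hrect {x | a < f x i} {y | g y i < a}
        (measurableSet_lt measurable_const ((measurable_pi_apply i).comp hf))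
        (measurableSet_lt ((measurable_pi_apply i).comp hg) measurable_const)
        fun x hx y hy hxy => lt_asymm (show a < f x i from hx)
          (by rw [hxy]; exact hy)
    filter_upwards [k1, k2] with z hz1 hz2
    ext i
    rcases lt_trichotomy (f z.1 i) (g z.2 i) with h | h | h
    · obtain ⟨a, ha⟩ := exists_rat_btwn h
      exact absurd ha (hz1 i a)
    · exact h
    · obtain ⟨a, ha⟩ := exists_rat_btwn h
      exact absurd ha.symm (hz2 i a)
  -- Superhedging `-c` is, up to sign, subhedging `c`.
  · obtain ⟨p, ⟨hp1, hp2, hp⟩, hlt⟩ := hΛc ε hε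
    refine ⟨-p.1, -p.2, hp1.neg, hp2.neg, fun x y hxy => ?_, ?_⟩
    · have := hp x y hxy
      simp only [Pi.neg_apply] at this ⊢
      linarith
    · rw [map_neg, hpre.map_eq_integral hπ1 hπ2 hπ hc huc] at hlt
      simp only [Pi.neg_apply, integral_neg]
      linarith

end StrongDuality

/-! ### Uniform bounds on dual pairs -/

section Normalization

variable {X Y Z : Type*} [MeasurableSpace X] [MeasurableSpace Y] [MeasurableSpace Z]

theorem BddMeas.integral_kernel {φ : X → ℝ} (hφ : BddMeas φ) (K : Kernel Z X) [IsMarkovKernel K] :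
    BddMeas (fun z => ∫ x, φ x ∂(K z)) := by
  obtain ⟨hm, C, hC⟩ := hφ
  refine ⟨(hm.stronglyMeasurable.integral_kernel (κ := K)).measurable, C, fun z => ?_⟩
  have := norm_integral_le_of_norm_le_const (μ := K z) (f := φ) (C := C) (ae_of_all _ hC)
  simpa using this

/-- The kernel is the regular conditional law of the identity given `f`. It charges only the fibre
because the graph of `f` carries the joint law. -/
theorem exists_disintegration [StandardBorelSpace X] [StandardBorelSpace Z] {μ : Measure X}
    [IsProbabilityMeasure μ] {f : X → Z} (hf : Measurable f) :
    ∃ K : Kernel Z X, IsMarkovKernel K ∧ (∀ᵐ z ∂μ.map f, ∀ᵐ x ∂K z, f x = z) ∧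
      ∀ φ : X → ℝ, BddMeas φ → ∀ s : Z → ℝ, BddMeas s →
        ∫ x, s (f x) * φ x ∂μ = ∫ z, s z * ∫ x, φ x ∂K z ∂μ.map f := by
  have : Nonempty X := nonempty_of_isProbabilityMeasure μ
  have : IsProbabilityMeasure (μ.map f) := Measure.isProbabilityMeasure_map hf.aemeasurable
  have hc := compProd_map_condDistrib (mβ := inferInstance) (X := f) (Y := id) (μ := μ)
    aemeasurable_id
  refine ⟨condDistrib id f μ, inferInstance, ?_, fun φ hφ s hs => ?_⟩
  · refine Measure.ae_ae_of_ae_compProd (p := fun z : Z × X => f z.2 = z.1) ?_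
    have hE : MeasurableSet {z : Z × X | f z.2 = z.1} :=
      measurableSet_eq_fun (hf.comp measurable_snd) measurable_fst
    rw [hc]
    exact (ae_map_iff (hf.prodMk measurable_id).aemeasurable hE).2 (ae_of_all _ fun x => rfl)
  · have hsφ : BddMeas (fun z : Z × X => s z.1 * φ z.2) := hs.prod_mul hφ
    have := Measure.integral_compProd (μ := μ.map f) (κ := condDistrib id f μ)
      (hsφ.integrable _)
    rw [hc, integral_map (hf.prodMk measurable_id).aemeasurable
      hsφ.1.aestronglyMeasurable] at this
    simp only [integral_const_mul, id] at this
    exact this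

variable [StandardBorelSpace X] [StandardBorelSpace Y] [StandardBorelSpace Z]
  {μ : Measure X} {ν : Measure Y} [IsProbabilityMeasure μ] [IsProbabilityMeasure ν]

/-- Dual pairs can be improved to pairs bounded by the upper bound of the cost. -/
theorem exists_dual_abs_le {f : X → Z} {g : Y → Z} (hf : Measurable f) (hg : Measurable g)
    (hfg : μ.map f = ν.map g) {c : X × Y → ℝ} {C : ℝ} (hc0 : ∀ z, 0 ≤ c z) (hcC : ∀ z, c z ≤ C)
    {φ : X → ℝ} {ψ : Y → ℝ} (hφ : BddMeas φ) (hψ : BddMeas ψ)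
    (hle : ∀ x y, f x = g y → φ x + ψ y ≤ c (x, y)) :
    ∃ φ' ψ', Measurable φ' ∧ Measurable ψ' ∧ (∀ x, |φ' x| ≤ C) ∧ (∀ y, |ψ' y| ≤ C) ∧
      (∀ x y, f x = g y → φ' x + ψ' y ≤ c (x, y)) ∧
      (∫ x, φ x ∂μ) + ∫ y, ψ y ∂ν ≤ (∫ x, φ' x ∂μ) + ∫ y, ψ' y ∂ν := by
  obtain ⟨x₀⟩ : Nonempty X := nonempty_of_isProbabilityMeasure μ
  obtain ⟨y₀⟩ : Nonempty Y := nonempty_of_isProbabilityMeasure ν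
  have hC : 0 ≤ C := (hc0 (x₀, y₀)).trans (hcC _)
  have : IsProbabilityMeasure (μ.map f) := Measure.isProbabilityMeasure_map hf.aemeasurable
  obtain ⟨K, _, hKf, hK⟩ := exists_disintegration (μ := μ) hf
  obtain ⟨L, _, hLg, hL⟩ := exists_disintegration (μ := ν) hg
  rw [← hfg] at hLg hL
  have hmap : ∀ s : Z → ℝ, BddMeas s → ∫ y, s (g y) ∂ν = ∫ z, s z ∂μ.map f := fun s hs => by
    rw [hfg, integral_map hg.aemeasurable hs.1.aestronglyMeasurable]
  have hmap' : ∀ s : Z → ℝ, BddMeas s → ∫ x, s (f x) ∂μ = ∫ z, s z ∂μ.map f := fun s hs => by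
    rw [integral_map hf.aemeasurable hs.1.aestronglyMeasurable]
  obtain ⟨Z₀, hZ₀, hZ₀m, hZ₀p⟩ := (hKf.and hLg).exists_measurable_mem
  -- Moving the fibre mean `a` of `φ` to `ψ` keeps the sum unchanged on the constraint set and makes
  -- `φ₁` average to zero on almost every fibre.
  set a : Z → ℝ := fun z => ∫ x, φ x ∂K z
  have ha : BddMeas a := hφ.integral_kernel K
  set φ₁ : X → ℝ := φ - a ∘ f
  set ψ₁ : Y → ℝ := ψ + a ∘ g
  have hφ₁ : BddMeas φ₁ := hφ.sub (ha.comp hf)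
  have hψ₁ : BddMeas ψ₁ := hψ.add (ha.comp hg)
  set b : Z → ℝ := fun z => ∫ y, ψ₁ y ∂L z
  have hb : BddMeas b := hψ₁.integral_kernel L
  have hle₁ : ∀ x y, f x = g y → φ₁ x + ψ₁ y ≤ c (x, y) := fun x y hxy => by
    have := hle x y hxy
    simp only [φ₁, ψ₁, Pi.sub_apply, Pi.add_apply, Function.comp, hxy]
    linarith
  -- Averaging the constraint over `x` in the fibre of `y` removes `φ` and leaves a one-sided bound.
  have hψC : ∀ y, g y ∈ Z₀ → ψ₁ y ≤ C := fun y hy => by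
    have : a (g y) ≤ C - ψ y := by
      calc a (g y) ≤ ∫ _, (C - ψ y) ∂K (g y) := by
            refine integral_mono_ae (hφ.integrable _) (integrable_const _) ?_
            filter_upwards [(hZ₀p _ hy).1] with x hx
            linarith [hle x y hx, hcC (x, y)]
        _ = C - ψ y := by simp
    simp only [ψ₁, Pi.add_apply, Function.comp]
    linarith
  have hφC : ∀ x, f x ∈ Z₀ → φ₁ x ≤ C - b (f x) := fun x hx => by
    have : b (f x) ≤ C - φ₁ x := by
      calc b (f x) ≤ ∫ _, (C - φ₁ x) ∂L (f x) := by
            refine integral_mono_ae (hψ₁.integrable _) (integrable_const _) ?_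
            filter_upwards [(hZ₀p _ hx).2] with y hy
            linarith [hle₁ x y hy.symm, hcC (x, y)]
        _ = C - φ₁ x := by simp
    linarith
  -- On fibres where the mean `b` of `ψ₁` is negative the pair `(0, 0)` does better, and it is
  -- feasible as `c ≥ 0`. Where `b ≥ 0`, the bound `C - b` on `φ₁` improves to `C`.
  set Z₁ : Set Z := Z₀ ∩ {z | 0 ≤ b z}
  have hZ₁ : MeasurableSet Z₁ := hZ₀m.inter (measurableSet_le measurable_const hb.1)
  set s : Z → ℝ := Z₁.indicator fun _ => 1
  have hs : BddMeas s := (BddMeas.const 1).indicator hZ₁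
  have hs1 : ∀ z ∈ Z₁, s z = 1 := fun z hz => Set.indicator_of_mem hz _
  have hs0 : ∀ z ∉ Z₁, s z = 0 := fun z hz => Set.indicator_of_notMem hz _
  set φ₂ : X → ℝ := (s ∘ f) * φ₁
  set ψ₂ : Y → ℝ := (s ∘ g) * ψ₁
  have hφ₂ : BddMeas φ₂ := (hs.comp hf).mul hφ₁
  have hψ₂ : BddMeas ψ₂ := (hs.comp hg).mul hψ₁
  have hle₂ : ∀ x y, f x = g y → φ₂ x + ψ₂ y ≤ c (x, y) := fun x y hxy => by
    simp only [φ₂, ψ₂, Pi.mul_apply, Function.comp, hxy]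
    by_cases hz : g y ∈ Z₁
    · simpa [hs1 _ hz] using hle₁ x y hxy
    · simpa [hs0 _ hz] using hc0 (x, y)
  have hφ₂C : ∀ x, φ₂ x ≤ C := fun x => by
    simp only [φ₂, Pi.mul_apply, Function.comp]
    by_cases hz : f x ∈ Z₁
    · rw [hs1 _ hz, one_mul]
      linarith [hφC x hz.1, show 0 ≤ b (f x) from hz.2]
    · simpa [hs0 _ hz] using hC
  have hψ₂C : ∀ y, ψ₂ y ≤ C := fun y => by
    simp only [ψ₂, Pi.mul_apply, Function.comp]
    by_cases hz : g y ∈ Z₁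
    · rw [hs1 _ hz, one_mul]
      exact hψC y hz.1
    · simpa [hs0 _ hz] using hC
  have hφ₂i : ∫ x, φ₂ x ∂μ = 0 := by
    have e : φ₂ = fun x => s (f x) * φ x - (s * a) (f x) := by
      ext x
      simp only [φ₂, φ₁, Pi.mul_apply, Pi.sub_apply, Function.comp]
      ring
    have i1 : Integrable (fun x => s (f x) * φ x) μ := ((hs.comp hf).mul hφ).integrable μ
    have i2 : Integrable (fun x => (s * a) (f x)) μ := ((hs.mul ha).comp hf).integrable μ
    rw [e, integral_sub i1 i2, hK φ hφ s hs, hmap' _ (hs.mul ha)]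
    exact sub_self _
  have hψ₂i : ∫ y, ψ₂ y ∂ν = ∫ z, s z * b z ∂μ.map f := hL ψ₁ hψ₁ s hs
  have hbi : ∫ z, b z ∂μ.map f = (∫ x, φ x ∂μ) + ∫ y, ψ y ∂ν := by
    have e1 := hL ψ₁ hψ₁ (fun _ => 1) (BddMeas.const 1)
    have e2 := hK φ hφ (fun _ => 1) (BddMeas.const 1)
    simp only [one_mul] at e1 e2
    rw [← e1, e2]
    simp only [ψ₁, Pi.add_apply]
    rw [integral_add (hψ.integrable ν) ((ha.comp hg).integrable ν), add_comm]
    congr 1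
    exact hmap a ha
  have hsb : ∫ z, b z ∂μ.map f ≤ ∫ z, s z * b z ∂μ.map f := by
    refine integral_mono_ae (hb.integrable _) ((hs.mul hb).integrable _) ?_
    filter_upwards [hZ₀] with z hz
    by_cases hz0 : 0 ≤ b z
    · rw [hs1 z ⟨hz, hz0⟩, one_mul]
    · rw [hs0 z fun h => hz0 h.2, zero_mul]
      exact (not_le.1 hz0).le
  -- Truncation from below only raises the integrals. It stays feasible: where one entry is `-C` the
  -- other is at most `C`, so the sum is at most `0 ≤ c`.
  refine ⟨fun x => max (φ₂ x) (-C), fun y => max (ψ₂ y) (-C), hφ₂.1.max measurable_const,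
    hψ₂.1.max measurable_const, fun x => abs_le.2 ⟨le_max_right _ _, max_le (hφ₂C x) (by linarith)⟩,
    fun x => abs_le.2 ⟨le_max_right _ _, max_le (hψ₂C x) (by linarith)⟩, fun x y hxy => ?_, ?_⟩
  · have k1 := hφ₂C x
    have k2 := hψ₂C y
    have k3 := hle₂ x y hxy
    have k4 := hc0 (x, y)
    dsimp only
    rcases max_choice (φ₂ x) (-C) with h1 | h1 <;> rcases max_choice (ψ₂ y) (-C) with h2 | h2 <;>
      rw [h1, h2] <;> linarith
  · have i1 : Integrable (fun x => max (φ₂ x) (-C)) μ :=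
      (hφ₂.integrable μ).sup (integrable_const _)
    have i2 : Integrable (fun x => max (ψ₂ x) (-C)) ν :=
      (hψ₂.integrable ν).sup (integrable_const _)
    have j1 := integral_mono (hφ₂.integrable μ) i1 fun x => le_max_left _ _
    have j2 := integral_mono (hψ₂.integrable ν) i2 fun x => le_max_left _ _
    linarith

end Normalization

/-! ### Attainment of the dual supremum -/

section Attainment

open Filter Topology

/-- Almost minimal elements of a decreasing sequence of bounded convex sets in a Hilbert space
converge. -/
theorem exists_tendsto_of_antitone_convex {H : Type*} [NormedAddCommGroup H]
    [InnerProductSpace ℝ H] [CompleteSpace H] {S : ℕ → Set H} (hS : Antitone S)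
    (hconv : ∀ n, Convex ℝ (S n)) (hne : ∀ n, (S n).Nonempty) {R : ℝ}
    (hR : ∀ n, ∀ x ∈ S n, ‖x‖ ≤ R) :
    ∃ p : ℕ → H, (∀ n, p n ∈ S n) ∧ ∃ q, Tendsto p atTop (𝓝 q) := by
  let I : ℕ → ℝ := fun n => sInf ((fun x : H => ‖x‖ ^ 2) '' S n)
  have hbdd : ∀ n, BddBelow ((fun x : H => ‖x‖ ^ 2) '' S n) := fun n =>
    ⟨0, by rintro _ ⟨x, -, rfl⟩; positivity⟩
  have hI : ∀ n, ∀ x ∈ S n, I n ≤ ‖x‖ ^ 2 := fun n x hx => csInf_le (hbdd n) ⟨x, hx, rfl⟩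
  have hmono : Monotone I := fun n m hnm =>
    csInf_le_csInf (hbdd n) ((hne m).image _) (Set.image_mono (hS hnm))
  have hIR : BddAbove (Set.range I) := by
    refine ⟨R ^ 2, ?_⟩
    rintro _ ⟨n, rfl⟩
    obtain ⟨x, hx⟩ := hne n
    exact (hI n x hx).trans (pow_le_pow_left₀ (norm_nonneg _) (hR n x hx) 2)
  have hex : ∀ n, ∃ x ∈ S n, ‖x‖ ^ 2 < I n + 1 / ((n : ℝ) + 1) := fun n => by
    obtain ⟨_, ⟨x, hx, rfl⟩, h⟩ := exists_lt_of_csInf_lt ((hne n).image fun x : H => ‖x‖ ^ 2)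
      (lt_add_of_pos_right (I n) (Nat.one_div_pos_of_nat (n := n)))
    exact ⟨x, hx, h⟩
  choose p hp hpI using hex
  have hlim := tendsto_atTop_ciSup hmono hIR
  set L := ⨆ n, I n
  have hIL : ∀ n, I n ≤ L := fun n => le_ciSup hIR n
  refine ⟨p, hp, cauchySeq_tendsto_of_complete (cauchySeq_of_le_tendsto_0
    (fun N => √(4 * (L - I N) + 4 * (1 / ((N : ℝ) + 1)))) (fun n m N hn hm => ?_) ?_)⟩
  -- The midpoint lies in `S N`, so its squared norm is at least `I N`; the parallelogram law then
  -- bounds the squared distance.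
  · have hmid : (1 / 2 : ℝ) • p n + (1 / 2 : ℝ) • p m ∈ S N :=
      hconv N (hS hn (hp n)) (hS hm (hp m)) (by norm_num) (by norm_num) (by norm_num)
    have h1 := hI N _ hmid
    rw [← smul_add, norm_smul, mul_pow] at h1
    have h2 := parallelogram_law_with_norm ℝ (p n) (p m)
    have h3 := hpI n
    have h4 := hpI m
    have h5 := Nat.one_div_le_one_div (α := ℝ) hn
    have h6 := Nat.one_div_le_one_div (α := ℝ) hm
    rw [dist_eq_norm]
    refine Real.le_sqrt_of_sq_le ?_
    norm_num at h1
    nlinarith [hIL n, hIL m]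
  · have h0 : Tendsto (fun N : ℕ => 4 * (L - I N) + 4 * (1 / ((N : ℝ) + 1))) atTop (𝓝 0) := by
      have := ((tendsto_const_nhds (x := L)).sub hlim).const_mul 4 |>.add
        ((tendsto_one_div_add_atTop_nhds_zero_nat (𝕜 := ℝ)).const_mul 4)
      simpa using this
    simpa using h0.sqrt

/-- A decreasing sequence of convex sets of uniformly bounded measurable functions admits a
selection that converges almost everywhere. -/
theorem exists_ae_tendsto_of_antitone_convex {W : Type*} [MeasurableSpace W] {ρ : Measure W}
    [IsFiniteMeasure ρ] {A : ℕ → Set (W → ℝ)} (hA : Antitone A) (hconv : ∀ n, Convex ℝ (A n))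
    (hne : ∀ n, (A n).Nonempty) (hm : ∀ n, ∀ h ∈ A n, Measurable h) {C : ℝ}
    (hC : ∀ n, ∀ h ∈ A n, ∀ w, |h w| ≤ C) :
    ∃ p : ℕ → W → ℝ, (∀ n, p n ∈ A n) ∧
      ∃ q : W → ℝ, ∀ᵐ w ∂ρ, Tendsto (fun n => p n w) atTop (𝓝 (q w)) := by
  have hLp : ∀ n, ∀ h ∈ A n, MemLp h 2 ρ := fun n h hh =>
    MemLp.of_bound (hm n h hh).aestronglyMeasurable C (ae_of_all _ (hC n h hh))
  let S : ℕ → Set (Lp ℝ 2 ρ) := fun n => {F | ∃ h ∈ A n, F =ᵐ[ρ] h}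
  obtain ⟨P, hP, Q, hPQ⟩ := exists_tendsto_of_antitone_convex (S := S)
    (R := (measureUnivNNReal ρ : ℝ) ^ (ENNReal.toReal 2)⁻¹ * |C|)
    (fun n m hnm F ⟨h, hh, e⟩ => ⟨h, hA hnm hh, e⟩)
    (by
      rintro n F ⟨h, hh, e⟩ G ⟨k, hk, e'⟩ a b ha hb hab
      refine ⟨a • h + b • k, hconv n hh hk ha hb hab, ?_⟩
      filter_upwards [e, e', Lp.coeFn_add (a • F) (b • G), Lp.coeFn_smul a F,
        Lp.coeFn_smul b G] with w h1 h2 h3 h4 h5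
      refine h3.trans ?_
      rw [Pi.add_apply, h4, h5, Pi.smul_apply, Pi.smul_apply, h1, h2]
      rfl)
    (fun n => by
      obtain ⟨h, hh⟩ := hne n
      exact ⟨(hLp n h hh).toLp h, h, hh, MemLp.coeFn_toLp _⟩)
    (by
      rintro n F ⟨h, hh, e⟩
      refine Lp.norm_le_of_ae_bound (abs_nonneg C) ?_
      filter_upwards [e] with w hw
      rw [hw]
      exact (hC n h hh w).trans (le_abs_self C))
  choose p hpA hp using hP
  have := tendstoInMeasure_of_tendsto_Lp hPQ
  obtain ⟨ns, hns, hlim⟩ := this.exists_seq_tendsto_ae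
  -- Since `k ≤ ns k` and the sets decrease, passing to the subsequence keeps the `k`-th term in `A
  -- k`.
  refine ⟨fun k => p (ns k), fun k => hA hns.le_apply (hpA _), Q, ?_⟩
  have hall : ∀ᵐ w ∂ρ, ∀ n, P n w = p n w := ae_all_iff.2 hp
  filter_upwards [hlim, hall] with w hw hw'
  simpa only [hw'] using hw

variable {X Y : Type*} [MeasurableSpace X] [MeasurableSpace Y]
  {μ : Measure X} {ν : Measure Y} [IsFiniteMeasure μ] [IsFiniteMeasure ν]

/-- The supremum over uniformly bounded dual pairs is attained. -/
theorem exists_dual_ge {R : X → Y → Prop} {c : X × Y → ℝ} {C v : ℝ} (hc0 : ∀ z, 0 ≤ c z)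
    (hC : 0 ≤ C)
    (h : ∀ ε > 0, ∃ φ ψ, Measurable φ ∧ Measurable ψ ∧ (∀ x, |φ x| ≤ C) ∧ (∀ y, |ψ y| ≤ C) ∧
      (∀ x y, R x y → φ x + ψ y ≤ c (x, y)) ∧ v - ε < (∫ x, φ x ∂μ) + ∫ y, ψ y ∂ν) :
    ∃ φ ψ, BddMeas φ ∧ BddMeas ψ ∧ (∀ x y, R x y → φ x + ψ y ≤ c (x, y)) ∧
      v ≤ (∫ x, φ x ∂μ) + ∫ y, ψ y ∂ν := by
  have hbm : ∀ {φ : X → ℝ}, Measurable φ → (∀ x, |φ x| ≤ C) → Integrable φ μ := fun hm hb =>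
    Integrable.of_bound hm.aestronglyMeasurable C (ae_of_all _ hb)
  have hbm' : ∀ {φ : Y → ℝ}, Measurable φ → (∀ x, |φ x| ≤ C) → Integrable φ ν := fun hm hb =>
    Integrable.of_bound hm.aestronglyMeasurable C (ae_of_all _ hb)
  -- A dual pair is encoded as one function on the disjoint union, so both components converge along
  -- the same subsequence.
  let A : ℕ → Set (X ⊕ Y → ℝ) := fun n => {k | Measurable k ∧ (∀ w, |k w| ≤ C) ∧
    (∀ x y, R x y → k (.inl x) + k (.inr y) ≤ c (x, y)) ∧
    v - 1 / ((n : ℝ) + 1) ≤ (∫ x, k (.inl x) ∂μ) + ∫ y, k (.inr y) ∂ν}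
  have hAanti : Antitone A := by
    rintro n m hnm k ⟨h1, h2, h3, h4⟩
    exact ⟨h1, h2, h3, by linarith [Nat.one_div_le_one_div (α := ℝ) hnm]⟩
  have hconv : ∀ n, Convex ℝ (A n) := by
    rintro n k ⟨h1, h2, h3, h4⟩ l ⟨h1', h2', h3', h4'⟩ a b ha hb hab
    refine ⟨(h1.const_smul a).add (h1'.const_smul b), fun w => ?_, fun x y hxy => ?_, ?_⟩
    · exact abs_le.2 (convex_Icc (-C) C (abs_le.1 (h2 w)) (abs_le.1 (h2' w)) ha hb hab)
    · have := add_le_add (mul_le_mul_of_nonneg_left (h3 x y hxy) ha)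
        (mul_le_mul_of_nonneg_left (h3' x y hxy) hb)
      rw [← add_mul, hab, one_mul] at this
      simp only [Pi.add_apply, Pi.smul_apply, smul_eq_mul]
      linarith
    · simp only [Pi.add_apply, Pi.smul_apply, smul_eq_mul]
      have i1 : Integrable (fun x => k (.inl x)) μ := hbm (h1.comp measurable_inl) fun x => h2 _
      have i2 : Integrable (fun x => l (.inl x)) μ := hbm (h1'.comp measurable_inl) fun x => h2' _
      have i3 : Integrable (fun x => k (.inr x)) ν := hbm' (h1.comp measurable_inr) fun x => h2 _
      have i4 : Integrable (fun x => l (.inr x)) ν := hbm' (h1'.comp measurable_inr) fun x => h2' _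
      rw [integral_add (i1.const_mul a) (i2.const_mul b),
        integral_add (i3.const_mul a) (i4.const_mul b)]
      simp only [integral_const_mul]
      have := add_le_add (mul_le_mul_of_nonneg_left h4 ha) (mul_le_mul_of_nonneg_left h4' hb)
      rw [← add_mul, hab, one_mul] at this
      linarith
  have hne : ∀ n, (A n).Nonempty := fun n => by
    obtain ⟨φ, ψ, h1, h2, h3, h4, h5, h6⟩ := h _ (Nat.one_div_pos_of_nat (n := n))
    refine ⟨Sum.elim φ ψ, h1.sumElim h2, ?_, h5, h6.le⟩
    rintro (x | y)
    exacts [h3 x, h4 y]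
  obtain ⟨p, hp, q, hq⟩ := exists_ae_tendsto_of_antitone_convex
    (ρ := μ.map Sum.inl + ν.map Sum.inr) hAanti hconv hne (fun n k hk => hk.1)
    (fun n k hk => hk.2.1)
  rw [ae_add_measure_iff] at hq
  obtain ⟨S, hS, hSm, hSp⟩ := (ae_of_ae_map measurable_inl.aemeasurable hq.1).exists_measurable_mem
  obtain ⟨T, hT, hTm, hTp⟩ := (ae_of_ae_map measurable_inr.aemeasurable hq.2).exists_measurable_mem
  classical
  -- The constraint must hold at every point, so the null sets without convergence need a value:
  -- `-C` makes it automatic, the other component being at most `C`.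
  let φn : ℕ → X → ℝ := fun n => S.piecewise (fun x => p n (.inl x)) fun _ => -C
  let ψn : ℕ → Y → ℝ := fun n => T.piecewise (fun x => p n (.inr x)) fun _ => -C
  let φ : X → ℝ := S.piecewise (fun x => q (.inl x)) fun _ => -C
  let ψ : Y → ℝ := T.piecewise (fun x => q (.inr x)) fun _ => -C
  have hφnm : ∀ n, Measurable (φn n) := fun n =>
    ((hp n).1.comp measurable_inl).piecewise hSm measurable_const
  have hψnm : ∀ n, Measurable (ψn n) := fun n =>
    ((hp n).1.comp measurable_inr).piecewise hTm measurable_const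
  have hφnC : ∀ n x, |φn n x| ≤ C := fun n x => by
    by_cases hx : x ∈ S
    · simpa [φn, hx] using (hp n).2.1 _
    · simp [φn, hx, abs_of_nonneg hC]
  have hψnC : ∀ n x, |ψn n x| ≤ C := fun n x => by
    by_cases hx : x ∈ T
    · simpa [ψn, hx] using (hp n).2.1 _
    · simp [ψn, hx, abs_of_nonneg hC]
  have hφlim : ∀ x, Tendsto (fun n => φn n x) atTop (𝓝 (φ x)) := fun x => by
    by_cases hx : x ∈ S
    · simpa [φn, φ, hx] using hSp x hx
    · simp [φn, φ, hx]
  have hψlim : ∀ x, Tendsto (fun n => ψn n x) atTop (𝓝 (ψ x)) := fun x => by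
    by_cases hx : x ∈ T
    · simpa [ψn, ψ, hx] using hTp x hx
    · simp [ψn, ψ, hx]
  refine ⟨φ, ψ, ⟨measurable_of_tendsto_metrizable hφnm (tendsto_pi_nhds.2 hφlim), C, fun x =>
      le_of_tendsto' (hφlim x).abs fun n => hφnC n x⟩,
    ⟨measurable_of_tendsto_metrizable hψnm (tendsto_pi_nhds.2 hψlim), C, fun x =>
      le_of_tendsto' (hψlim x).abs fun n => hψnC n x⟩, fun x y hxy => ?_, ?_⟩
  · refine le_of_tendsto' ((hφlim x).add (hψlim y)) fun n => ?_
    have k1 := (abs_le.1 (hφnC n x)).2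
    have k2 := (abs_le.1 (hψnC n y)).2
    by_cases hx : x ∈ S
    · by_cases hy : y ∈ T
      · simpa [φn, ψn, hx, hy] using (hp n).2.2.1 x y hxy
      · have : ψn n y = -C := by simp [ψn, hy]
        linarith [hc0 (x, y)]
    · have : φn n x = -C := by simp [φn, hx]
      linarith [hc0 (x, y)]
  · have l1 : Tendsto (fun n => ∫ x, φn n x ∂μ) atTop (𝓝 (∫ x, φ x ∂μ)) :=
      tendsto_integral_of_dominated_convergence (fun _ => C)
        (fun n => (hφnm n).aestronglyMeasurable) (integrable_const _)
        (fun n => ae_of_all _ (hφnC n)) (ae_of_all _ hφlim)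
    have l2 : Tendsto (fun n => ∫ x, ψn n x ∂ν) atTop (𝓝 (∫ x, ψ x ∂ν)) :=
      tendsto_integral_of_dominated_convergence (fun _ => C)
        (fun n => (hψnm n).aestronglyMeasurable) (integrable_const _)
        (fun n => ae_of_all _ (hψnC n)) (ae_of_all _ hψlim)
    have l3 : Tendsto (fun n : ℕ => v - 1 / ((n : ℝ) + 1)) atTop (𝓝 v) := by
      simpa using (tendsto_const_nhds (x := v)).sub
        (tendsto_one_div_add_atTop_nhds_zero_nat (𝕜 := ℝ))
    refine le_of_tendsto_of_tendsto' l3 (l1.add l2) fun n => ?_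
    have e1 : ∫ x, φn n x ∂μ = ∫ x, p n (.inl x) ∂μ := integral_congr_ae <| by
      filter_upwards [hS] with x hx
      simp [φn, hx]
    have e2 : ∫ x, ψn n x ∂ν = ∫ x, p n (.inr x) ∂ν := integral_congr_ae <| by
      filter_upwards [hT] with x hx
      simp [ψn, hx]
    rw [e1, e2]
    exact (hp n).2.2.2

end Attainment

/-! ### Transport plans as density-preserving couplings -/

section Tuples

open scoped ENNReal

variable {X Y : Type*} [MeasurableSpace X] [MeasurableSpace Y] {d : ℕ}

theorem measurable_density (μ : Fin d → Measure X) : Measurable (density μ) :=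
  measurable_pi_lambda _ fun j => ((μ j).measurable_rnDeriv (avg μ)).ennreal_toReal

variable {μ : Fin d → Measure X} {ν : Fin d → Measure Y} [∀ j, IsFiniteMeasure (μ j)]
  [∀ j, IsFiniteMeasure (ν j)]

theorem sum_univ_ne_top : ∑ j, μ j Set.univ ≠ ∞ :=
  ENNReal.sum_ne_top.2 fun _ _ => measure_ne_top _ _

omit [∀ j, IsFiniteMeasure (μ j)] in
theorem sum_univ_ne_zero (hd : 1 ≤ d) (hμ : ∀ j, μ j ≠ 0) : ∑ j, μ j Set.univ ≠ 0 := fun h =>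
  hμ ⟨0, hd⟩ (Measure.measure_univ_eq_zero.1 (Finset.sum_eq_zero_iff.1 h _ (Finset.mem_univ _)))

omit [∀ j, IsFiniteMeasure (μ j)] in
theorem avg_apply (s : Set X) : avg μ s = (∑ j, μ j Set.univ)⁻¹ * ∑ j, μ j s := by
  simp [avg]

theorem isProbabilityMeasure_avg (hd : 1 ≤ d) (hμ : ∀ j, μ j ≠ 0) :
    IsProbabilityMeasure (avg μ) :=
  ⟨by rw [avg_apply, ENNReal.inv_mul_cancel (sum_univ_ne_zero hd hμ) sum_univ_ne_top]⟩

theorem le_smul_avg (hd : 1 ≤ d) (hμ : ∀ j, μ j ≠ 0) (j : Fin d) (s : Set X) :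
    μ j s ≤ (∑ j, μ j Set.univ) * avg μ s := by
  rw [avg_apply, ← mul_assoc, ENNReal.mul_inv_cancel (sum_univ_ne_zero hd hμ) sum_univ_ne_top,
    one_mul]
  exact Finset.single_le_sum (f := fun j => μ j s) (fun _ _ => zero_le) (Finset.mem_univ j)

theorem absolutelyContinuous_avg (hd : 1 ≤ d) (hμ : ∀ j, μ j ≠ 0) (j : Fin d) :
    μ j ≪ avg μ := fun s hs => by
  simpa [hs] using le_smul_avg hd hμ j s

/-- Each `μ j` is at most the total mass times the average. The resulting bound puts the densities
in `L²`, as the second moment argument requires. -/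
theorem ae_rnDeriv_avg_le (hd : 1 ≤ d) (hμ : ∀ j, μ j ≠ 0) (j : Fin d) :
    ∀ᵐ x ∂avg μ, (μ j).rnDeriv (avg μ) x ≤ ∑ j, μ j Set.univ := by
  have := isProbabilityMeasure_avg hd hμ
  refine ae_le_of_forall_setLIntegral_le_of_sigmaFinite (Measure.measurable_rnDeriv _ _)
    fun s _ _ => ?_
  rw [setLIntegral_const]
  exact (Measure.setLIntegral_rnDeriv_le s).trans (le_smul_avg hd hμ j s)

theorem ae_density_mem (hd : 1 ≤ d) (hμ : ∀ j, μ j ≠ 0) (j : Fin d) :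
    ∀ᵐ x ∂avg μ, ‖density μ x j‖ ≤ (∑ j, μ j Set.univ).toReal := by
  filter_upwards [ae_rnDeriv_avg_le hd hμ j] with x hx
  rw [Real.norm_of_nonneg (show 0 ≤ density μ x j from ENNReal.toReal_nonneg)]
  exact ENNReal.toReal_mono sum_univ_ne_top hx

theorem memLp_density (hd : 1 ≤ d) (hμ : ∀ j, μ j ≠ 0) (j : Fin d) :
    MemLp (fun x => density μ x j) 2 (avg μ) :=
  have := isProbabilityMeasure_avg hd hμ
  MemLp.of_bound ((measurable_pi_apply j).comp (measurable_density μ)).aestronglyMeasurable _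
    (ae_density_mem hd hμ j)

/-- Weighting the plan by the `j`-th density replaces `avg μ` by `μ j` as the initial law of the
kernel. -/
theorem lintegral_rnDeriv_mul_compProd (hd : 1 ≤ d) (hμ : ∀ j, μ j ≠ 0) (κ : Kernel X Y)
    [IsMarkovKernel κ] (j : Fin d) {h : Y → ℝ≥0∞} (hh : Measurable h) :
    ∫⁻ z, (μ j).rnDeriv (avg μ) z.1 * h z.2 ∂(avg μ).compProd κ = ∫⁻ y, h y ∂(μ j).bind κ := by
  have := isProbabilityMeasure_avg hd hμ
  have hF := (μ j).measurable_rnDeriv (avg μ)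
  have hFh : Measurable fun z : X × Y => (μ j).rnDeriv (avg μ) z.1 * h z.2 :=
    (hF.comp measurable_fst).mul (hh.comp measurable_snd)
  rw [Measure.lintegral_compProd hFh,
    Measure.lintegral_bind κ.measurable.aemeasurable hh.aemeasurable,
    ← lintegral_rnDeriv_mul (absolutelyContinuous_avg hd hμ j) hh.lintegral_kernel.aemeasurable]
  refine lintegral_congr fun x => ?_
  rw [← lintegral_const_mul _ hh]

omit [∀ j, IsFiniteMeasure (μ j)] [∀ j, IsFiniteMeasure (ν j)] in
theorem avg_bind_eq (κ : Kernel X Y) [IsMarkovKernel κ] (h : ∀ j, (μ j).bind κ = ν j) :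
    (avg μ).bind κ = avg ν := by
  have hu : ∀ j, ν j Set.univ = μ j Set.univ := fun j => by
    rw [← h j, Measure.bind_apply MeasurableSet.univ κ.measurable.aemeasurable]
    simp
  ext s hs
  rw [Measure.bind_apply hs κ.measurable.aemeasurable, avg_apply, avg, lintegral_smul_measure,
    lintegral_finsetSum_measure, smul_eq_mul]
  simp_rw [hu, ← h, Measure.bind_apply hs κ.measurable.aemeasurable]

omit [∀ j, IsFiniteMeasure (ν j)] in
theorem snd_compProd_avg (hd : 1 ≤ d) (hμ : ∀ j, μ j ≠ 0) (κ : Kernel X Y) [IsMarkovKernel κ]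
    (h : ∀ j, (μ j).bind κ = ν j) : ((avg μ).compProd κ).snd = avg ν := by
  have := isProbabilityMeasure_avg hd hμ
  rw [Measure.snd_compProd]
  exact avg_bind_eq κ h

/-- This is the martingale property of the densities, tested against the density of `ν j` itself. -/
theorem integral_density_mul_density (hd : 1 ≤ d) (hμ : ∀ j, μ j ≠ 0) (hν : ∀ j, ν j ≠ 0)
    (κ : Kernel X Y) [IsMarkovKernel κ] (h : ∀ j, (μ j).bind κ = ν j) (j : Fin d) :
    ∫ z, density μ z.1 j * density ν z.2 j ∂(avg μ).compProd κ =
      ∫ y, density ν y j ^ 2 ∂avg ν := by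
  have := isProbabilityMeasure_avg hd hμ
  have := isProbabilityMeasure_avg hd hν
  have hF := (μ j).measurable_rnDeriv (avg μ)
  have hG := (ν j).measurable_rnDeriv (avg ν)
  have hFf : ∀ᵐ z ∂(avg μ).compProd κ, (μ j).rnDeriv (avg μ) z.1 < ∞ := by
    refine ae_of_ae_map (f := Prod.fst) (p := fun x => (μ j).rnDeriv (avg μ) x < ∞)
      measurable_fst.aemeasurable ?_
    change ∀ᵐ x ∂((avg μ).compProd κ).fst, _
    rw [Measure.fst_compProd]
    exact Measure.rnDeriv_lt_top _ _
  have hGf : ∀ᵐ z ∂(avg μ).compProd κ, (ν j).rnDeriv (avg ν) z.2 < ∞ := by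
    refine ae_of_ae_map (f := Prod.snd) (p := fun x => (ν j).rnDeriv (avg ν) x < ∞)
      measurable_snd.aemeasurable ?_
    change ∀ᵐ x ∂((avg μ).compProd κ).snd, _
    rw [snd_compProd_avg hd hμ κ h]
    exact Measure.rnDeriv_lt_top _ _
  simp only [density, ← ENNReal.toReal_mul, ← ENNReal.toReal_pow]
  rw [integral_toReal, integral_toReal, lintegral_rnDeriv_mul_compProd hd hμ κ j hG, h j,
    ← lintegral_rnDeriv_mul (absolutelyContinuous_avg hd hν j) hG.aemeasurable]
  · simp only [sq]
  · exact (hG.pow_const 2).aemeasurable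
  · filter_upwards [Measure.rnDeriv_lt_top (ν j) (avg ν)] with y hy
    exact ENNReal.pow_lt_top hy
  · exact ((hF.comp measurable_fst).mul (hG.comp measurable_snd)).aemeasurable
  · filter_upwards [hFf, hGf] with z h1 h2
    exact ENNReal.mul_lt_top h1 h2

theorem memLp_density_fst (hd : 1 ≤ d) (hμ : ∀ j, μ j ≠ 0) {π : Measure (X × Y)}
    (h1 : π.fst = avg μ) (j : Fin d) : MemLp (fun z : X × Y => density μ z.1 j) 2 π :=
  MemLp.comp_of_map (f := Prod.fst) (μ := π) (g := fun x => density μ x j)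
    (by rw [← Measure.fst, h1]; exact memLp_density hd hμ j) measurable_fst.aemeasurable

theorem memLp_density_snd (hd : 1 ≤ d) (hν : ∀ j, ν j ≠ 0) {π : Measure (X × Y)}
    (h2 : π.snd = avg ν) (j : Fin d) : MemLp (fun z : X × Y => density ν z.2 j) 2 π :=
  MemLp.comp_of_map (f := Prod.snd) (μ := π) (g := fun x => density ν x j)
    (by rw [← Measure.snd, h2]; exact memLp_density hd hν j) measurable_snd.aemeasurable

/-- Expand the square: the cross term equals the second moment on the `ν` side, so only the
difference of second moments survives. -/
theorem integral_sq_density_sub (hd : 1 ≤ d) (hμ : ∀ j, μ j ≠ 0) (hν : ∀ j, ν j ≠ 0)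
    (κ : Kernel X Y) [IsMarkovKernel κ] (h : ∀ j, (μ j).bind κ = ν j) (j : Fin d) :
    Integrable (fun z => (density μ z.1 j - density ν z.2 j) ^ 2) ((avg μ).compProd κ) ∧
    ∫ z, (density μ z.1 j - density ν z.2 j) ^ 2 ∂(avg μ).compProd κ =
      (∫ x, density μ x j ^ 2 ∂avg μ) - ∫ y, density ν y j ^ 2 ∂avg ν := by
  have := isProbabilityMeasure_avg hd hμ
  have h1 : ((avg μ).compProd κ).fst = avg μ := Measure.fst_compProd _ _
  have h2 := snd_compProd_avg hd hμ κ h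
  have m1 := memLp_density_fst hd hμ h1 j
  have m2 := memLp_density_snd hd hν h2 j
  refine ⟨(m1.sub m2).integrable_sq, ?_⟩
  have e := integral_add_integral_of_coupling h1 h2 (memLp_density hd hμ j).integrable_sq
    (memLp_density hd hν j).integrable_sq
  have i3 : Integrable (fun z : X × Y => density μ z.1 j * density ν z.2 j)
    ((avg μ).compProd κ) := m1.integrable_mul m2
  have e2 : (fun z : X × Y => (density μ z.1 j - density ν z.2 j) ^ 2) = fun z =>
      (density μ z.1 j ^ 2 + density ν z.2 j ^ 2) - 2 * (density μ z.1 j * density ν z.2 j) := by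
    ext z; ring
  rw [e2, integral_sub e.1 (i3.const_mul 2), e.2, integral_const_mul,
    integral_density_mul_density hd hμ hν κ h j]
  ring

/-- If transport is possible in both directions, then transport kernels transport exactly. -/
theorem bind_eq_of_mem_transportKernels (hνμ : (transportPlans ν μ).Nonempty) {κ : Kernel X Y}
    (hκ : κ ∈ transportKernels μ ν) (j : Fin d) : (μ j).bind κ = ν j := by
  obtain ⟨_, κ', hκ', -⟩ := hνμ
  have := hκ.1
  have := hκ'.1
  have u1 : (μ j).bind κ Set.univ = μ j Set.univ := by
    rw [Measure.bind_apply MeasurableSet.univ κ.measurable.aemeasurable]; simp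
  have u2 : (ν j).bind κ' Set.univ = ν j Set.univ := by
    rw [Measure.bind_apply MeasurableSet.univ κ'.measurable.aemeasurable]; simp
  have : IsFiniteMeasure ((μ j).bind κ) := ⟨by rw [u1]; exact measure_lt_top _ _⟩
  refine (Measure.eq_of_le_of_measure_univ_eq (hκ.2 j) (le_antisymm (hκ.2 j _) ?_)).symm
  rw [u1, ← u2]
  exact hκ'.2 j _

/-- Transport plans are couplings of the averages that preserve the densities. -/
theorem transportPlans_subset (hd : 1 ≤ d) (hμ : ∀ j, μ j ≠ 0) (hν : ∀ j, ν j ≠ 0)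
    (hμν : (transportPlans μ ν).Nonempty) (hνμ : (transportPlans ν μ).Nonempty)
    {π : Measure (X × Y)} (hπ : π ∈ transportPlans μ ν) :
    π.fst = avg μ ∧ π.snd = avg ν ∧ ∀ᵐ z ∂π, density μ z.1 = density ν z.2 := by
  have := isProbabilityMeasure_avg hd hμ
  obtain ⟨κ, hκ, rfl⟩ := hπ
  obtain ⟨_, κ', hκ', -⟩ := id hνμ
  have := hκ.1
  have := hκ'.1
  have hb := bind_eq_of_mem_transportKernels hνμ hκ
  have hb' := bind_eq_of_mem_transportKernels hμν hκ'
  refine ⟨Measure.fst_compProd _ _, snd_compProd_avg hd hμ κ hb, ?_⟩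
  have hj : ∀ j, ∀ᵐ z ∂(avg μ).compProd κ, density μ z.1 j = density ν z.2 j := fun j => by
    obtain ⟨i1, e1⟩ := integral_sq_density_sub hd hμ hν κ hb j
    obtain ⟨-, e2⟩ := integral_sq_density_sub hd hν hμ κ' hb' j
    have n1 : 0 ≤ ∫ z, (density μ z.1 j - density ν z.2 j) ^ 2 ∂(avg μ).compProd κ :=
      integral_nonneg fun z => sq_nonneg _
    have n2 : 0 ≤ ∫ z, (density ν z.1 j - density μ z.2 j) ^ 2 ∂(avg ν).compProd κ' :=
      integral_nonneg fun z => sq_nonneg _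
    -- The two mean square differences, one for each direction, are nonnegative and sum to zero.
    have h0 : ∫ z, (density μ z.1 j - density ν z.2 j) ^ 2 ∂(avg μ).compProd κ = 0 := by linarith
    rw [integral_eq_zero_iff_of_nonneg (fun z => sq_nonneg _) i1] at h0
    filter_upwards [h0] with z hz
    exact sub_eq_zero.1 (pow_eq_zero_iff two_ne_zero |>.1 hz)
  filter_upwards [ae_all_iff.2 hj] with z hz
  exact funext hz

/-- Couplings of the averages that preserve the densities are transport plans. -/
theorem mem_transportPlans [StandardBorelSpace Y] (hd : 1 ≤ d) (hμ : ∀ j, μ j ≠ 0)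
    (hν : ∀ j, ν j ≠ 0) {π : Measure (X × Y)} (h1 : π.fst = avg μ) (h2 : π.snd = avg ν)
    (hπ : ∀ᵐ z ∂π, density μ z.1 = density ν z.2) : π ∈ transportPlans μ ν := by
  have := isProbabilityMeasure_avg hd hμ
  have := isProbabilityMeasure_avg hd hν
  have : Nonempty Y := nonempty_of_isProbabilityMeasure (avg ν)
  have : IsProbabilityMeasure π := ⟨by rw [← Measure.fst_univ, h1]; simp⟩
  have hdis : (avg μ).compProd π.condKernel = π := by rw [← h1]; exact π.disintegrate _
  refine ⟨π.condKernel, ⟨inferInstance, fun j => le_of_eq ?_⟩, hdis.symm⟩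
  have hFf : ∀ᵐ z ∂π, (μ j).rnDeriv (avg μ) z.1 ≠ ∞ := by
    refine ae_of_ae_map (f := Prod.fst) (p := fun x => (μ j).rnDeriv (avg μ) x ≠ ∞)
      measurable_fst.aemeasurable ?_
    change ∀ᵐ x ∂π.fst, _
    rw [h1]
    exact Measure.rnDeriv_ne_top _ _
  have hGf : ∀ᵐ z ∂π, (ν j).rnDeriv (avg ν) z.2 ≠ ∞ := by
    refine ae_of_ae_map (f := Prod.snd) (p := fun x => (ν j).rnDeriv (avg ν) x ≠ ∞)
      measurable_snd.aemeasurable ?_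
    change ∀ᵐ x ∂π.snd, _
    rw [h2]
    exact Measure.rnDeriv_ne_top _ _
  ext s hs
  have hs1 : Measurable (s.indicator (1 : Y → ℝ≥0∞)) := measurable_one.indicator hs
  have hG := (ν j).measurable_rnDeriv (avg ν)
  -- Both sides become integrals over `π` of the indicator of `s` in `y`, weighted by the density of
  -- `μ j` on one side and of `ν j` on the other; these weights agree almost everywhere.
  rw [← lintegral_indicator_one hs, ← lintegral_indicator_one hs,
    ← lintegral_rnDeriv_mul_compProd hd hμ π.condKernel j hs1, hdis,
    ← lintegral_rnDeriv_mul (absolutelyContinuous_avg hd hν j) hs1.aemeasurable, ← h2,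
    Measure.snd, lintegral_map (by rw [← Measure.snd, h2]; exact hG.mul hs1) measurable_snd,
    ← Measure.snd, h2]
  refine lintegral_congr_ae ?_
  filter_upwards [hFf, hGf, hπ] with z z1 z2 hz
  have : (μ j).rnDeriv (avg μ) z.1 = (ν j).rnDeriv (avg ν) z.2 :=
    (ENNReal.toReal_eq_toReal_iff' z1 z2).1 (congrFun hz j)
  rw [this]

end Tuples

end SOT

end

/-! ### The duality theorem -/

theorem proposition4p6 {X Y : Type*}
    [MetricSpace X] [PolishSpace X] [MeasurableSpace X] [BorelSpace X]
    [MetricSpace Y] [PolishSpace Y] [MeasurableSpace Y] [BorelSpace Y]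
    {d : ℕ} (hd : 1 ≤ d)
    (μ : Fin d → Measure X) (ν : Fin d → Measure Y)
    [∀ j, IsFiniteMeasure (μ j)] [∀ j, IsFiniteMeasure (ν j)]
    (hμ : ∀ j, μ j ≠ 0) (hν : ∀ j, ν j ≠ 0)
    (hμν : (SOT.transportPlans μ ν).Nonempty) (hνμ : (SOT.transportPlans ν μ).Nonempty)
    (c : X × Y → ℝ) (hc_nonneg : ∀ z, 0 ≤ c z) (hc_bdd : ∃ C, ∀ z, c z ≤ C)
    (hc : UniformContinuous c) :
    ∃ v : ℝ,
      IsLeast ((fun π : Measure (X × Y) => ∫ z, c z ∂π) '' SOT.transportPlans μ ν) v ∧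
      IsGreatest ((fun p : (X → ℝ) × (Y → ℝ) =>
        (∫ x, p.1 x ∂(SOT.avg μ)) + (∫ y, p.2 y ∂(SOT.avg ν))) '' SOT.dualPairs μ ν c) v := by
  have := SOT.isProbabilityMeasure_avg hd hμ
  have := SOT.isProbabilityMeasure_avg hd hν
  obtain ⟨C, hC⟩ := hc_bdd
  have hcb : c ∈ SOT.boundedFunctions (X × Y) :=
    ⟨C, fun z => by rw [abs_of_nonneg (hc_nonneg z)]; exact hC z⟩
  have hcm : SOT.BddMeas c := ⟨hc.continuous.measurable, hcb⟩
  have hplan := fun π (hπ : π ∈ SOT.transportPlans μ ν) =>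
    SOT.transportPlans_subset hd hμ hν hμν hνμ hπ
  obtain ⟨γ, hγ⟩ := id hμν
  obtain ⟨hγ1, hγ2, hγd⟩ := hplan γ hγ
  have hC0 : 0 ≤ C := by
    obtain ⟨x⟩ := nonempty_of_isProbabilityMeasure (SOT.avg μ)
    obtain ⟨y⟩ := nonempty_of_isProbabilityMeasure (SOT.avg ν)
    exact (hc_nonneg (x, y)).trans (hC _)
  -- Any plan `γ` shows that the two density vectors have the same law, so the fibres on both sides
  -- can be disintegrated over a common base.
  have hmap : (SOT.avg μ).map (SOT.density μ) = (SOT.avg ν).map (SOT.density ν) := by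
    rw [← hγ1, ← hγ2, Measure.fst, Measure.snd,
      Measure.map_map (SOT.measurable_density μ) measurable_fst,
      Measure.map_map (SOT.measurable_density ν) measurable_snd]
    exact Measure.map_congr hγd
  obtain ⟨π, hπ1, hπ2, hπd, hπ⟩ := SOT.exists_coupling_forall_exists_dual
    (SOT.measurable_density μ) (SOT.measurable_density ν) hγ1 hγ2 hγd hcb hc
  have hπmem := SOT.mem_transportPlans hd hμ hν hπ1 hπ2 hπd
  have weak : ∀ π' ∈ SOT.transportPlans μ ν, ∀ p ∈ SOT.dualPairs μ ν c,
      (∫ x, p.1 x ∂(SOT.avg μ)) + (∫ y, p.2 y ∂(SOT.avg ν)) ≤ ∫ z, c z ∂π' := by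
    intro π' hπ' p hp
    obtain ⟨k1, k2, k3⟩ := hplan π' hπ'
    have : IsProbabilityMeasure π' := ⟨by rw [← Measure.fst_univ, k1]; simp⟩
    obtain ⟨i, e⟩ := SOT.integral_add_integral_of_coupling k1 k2 hp.1 hp.2.1
    rw [← e]
    refine integral_mono_ae i (hcm.integrable π') ?_
    filter_upwards [k3] with z hz
    exact hp.2.2 _ _ hz
  obtain ⟨φ, ψ, hφ, hψ, hφψ, hge⟩ := SOT.exists_dual_ge (μ := SOT.avg μ) (ν := SOT.avg ν)
    (R := fun x y => SOT.density μ x = SOT.density ν y) (v := ∫ z, c z ∂π) hc_nonneg hC0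
    fun ε hε => by
      obtain ⟨φ, ψ, hφ, hψ, hle, hlt⟩ := hπ ε hε
      obtain ⟨φ', ψ', m1, m2, b1, b2, hle', hlt'⟩ := SOT.exists_dual_abs_le
        (SOT.measurable_density μ) (SOT.measurable_density ν) hmap hc_nonneg hC hφ hψ hle
      exact ⟨φ', ψ', m1, m2, b1, b2, hle', hlt.trans_le hlt'⟩
  have hmem : (φ, ψ) ∈ SOT.dualPairs μ ν c := ⟨hφ.integrable _, hψ.integrable _, hφψ⟩
  refine ⟨∫ z, c z ∂π, ⟨⟨π, hπmem, rfl⟩, ?_⟩, ⟨⟨(φ, ψ), hmem, ?_⟩, ?_⟩⟩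
  · rintro _ ⟨π', hπ', rfl⟩
    exact hge.trans (weak π' hπ' _ hmem)
  · exact le_antisymm (weak π hπmem _ hmem) hge
  · rintro _ ⟨p, hp, rfl⟩
    exact weak π hπmem p hp
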